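/- For $n\ge 2$ let $B_n$ be the braid matroid, i.e. the linear matroid of the normal vectors $e_i-e_j$ ($1\le i<j\le n$) of the braid arrangement $\{z_i=z_j\}\subseteq \mathbb{C}^n/\mathbb{C}\cdot(1,\dots,1)$. Let $\operatorname{CH}^\star(B_n)$ be its rational Chow ring with respect to the maximal building set: the quotient of $\mathbb{Q}[x_F : F \text{ a nonempty flat of } B_n]$ by the ideal generated by the products $x_Fx_G$ for incomparable flats $F,G$ and by the sums $\sum_{F\ni e}x_F$ for all elements $e$ of the ground set, graded by $\deg x_F=1$. This is a finite-dimensional graded $\mathbb{Q}$-algebra. Set $\mathrm{H}^{\mathrm{num}}_1(t)=1$ and $\chi_1=1$, and for $n\ge 2$ set \[ \mathrm{H}^{\mathrm{num}}_n(t)=\sum_{k\ge 0}\dim_{\mathbb{Q}}\operatorname{CH}^k(B_n)\, t^k\in\mathbb{Z}[t],\qquad \chi_n=\dim_{\mathbb{Q}}\operatorname{CH}^\star(B_n). \] Let $s(n,k)$ denote the signed Stirling numbers of the first kind and $S(n,k)$ the Stirling numbers of the second kind. Then for all $n\ge 2$: 1. $\displaystyle (t-1)\,\mathrm{H}^{\mathrm{num}}_n(t)=\sum_{k=1}^{n-1}\mathrm{H}^{\mathrm{num}}_k(t)\sum_{j=k}^{n}s(n,j)\,S(j,k)\,t^{j-k}$;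 2. $\displaystyle \chi_n=\sum_{k=1}^{n-1}\chi_k\binom{n}{k-1}(n-k-1)!\,(-1)^{n-k-1}$. -/

import Mathlib

open Polynomial

noncomputable section

namespace BraidChow

/-- The linear matroid of a finite family of vectors `v`: its ground set is the whole index type,
and a set of indices is independent iff the corresponding subfamily is linearly independent. -/
def vectorMatroid (K : Type*) {W α : Type*} [Field K] [AddCommGroup W] [Module K W] [Finite α]
    (v : α → W) : Matroid α :=
  (IndepMatroid.ofFinite (E := Set.univ) Set.finite_univ (fun I => LinearIndepOn K v I)
    (linearIndepOn_empty K v)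
    (fun _ _ hJ hIJ => hJ.mono hIJ)
    (by
      intro I J hI hJ hlt
      by_contra! hcon
      have hsub : v '' J ⊆ Submodule.span K (v '' I) := by
        rintro _ ⟨e, he, rfl⟩
        by_cases heI : e ∈ I
        · exact Submodule.subset_span ⟨e, heI, rfl⟩
        · by_contra hns
          exact hcon e he heI (hI.insert hns)
      have : Fintype α := Fintype.ofFinite α
      classical
      have hJI : Module.finrank K (Submodule.span K (v '' J)) ≤
          Module.finrank K (Submodule.span K (v '' I)) := by
        have : FiniteDimensional K (Submodule.span K (v '' I)) :=
          FiniteDimensional.span_of_finite K (Set.toFinite _)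
        exact Submodule.finrank_mono (Submodule.span_le.2 hsub)
      have key : ∀ S : Set α, LinearIndepOn K v S →
          Module.finrank K (Submodule.span K (v '' S)) = S.ncard := by
        intro S hS
        have h := finrank_span_eq_card (R := K) (b := fun i : S => v i) hS
        have hr : Set.range (fun i : S => v i) = v '' S := by
          ext x; simp
        rw [hr] at h
        rw [h, ← Nat.card_eq_fintype_card, Nat.card_coe_set_eq]
      rw [key I hI, key J hJ] at hJI
      omega)
    (fun _ _ => Set.subset_univ _)).matroid

/-- The index set of the hyperplanes `z_i = z_j` of the braid arrangement
(equivalently, of the edges of the complete graph on `n` vertices). -/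
abbrev Pair (n : ℕ) : Type := {p : Fin n × Fin n // p.1 < p.2}

/-- The normal vector `e_i - e_j` of the hyperplane `z_i = z_j`. It lies in the subspace of vectors
with coordinate sum zero, which is the dual space of `ℂⁿ / ℂ·(1, …, 1)`. -/
def normalVector (n : ℕ) (p : Pair n) : Fin n → ℂ :=
  Pi.single p.1.1 1 - Pi.single p.1.2 1

/-- The braid matroid `B_n`, i.e. the matroid of the normal vectors of the braid arrangement. -/
def braidMatroid (n : ℕ) : Matroid (Pair n) :=
  vectorMatroid ℂ (normalVector n)

/-- The nonempty flats of a (loopless) matroid: the maximal building set of its lattice of flats. -/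
abbrev NonemptyFlat {α : Type*} (M : Matroid α) : Type _ := {F : Set α // M.IsFlat F ∧ F.Nonempty}

/-- The ideal of relations of the Chow ring of a loopless matroid on a finite type, with respect to
the maximal building set (Feichtner and Yuzvinsky). It is generated by the products `x_F x_G` for
incomparable flats `F`, `G`, and by the sums of all `x_F` with `e ∈ F`, for `e` in the ground
set. -/
def chowIdeal {α : Type*} [Finite α] (M : Matroid α) :
    Ideal (MvPolynomial (NonemptyFlat M) ℚ) :=
  Ideal.span
    ({q | ∃ F G : NonemptyFlat M, ¬ F.1 ⊆ G.1 ∧ ¬ G.1 ⊆ F.1 ∧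
        q = MvPolynomial.X F * MvPolynomial.X G} ∪
     {q | ∃ e ∈ M.E, q = ∑ᶠ (F : NonemptyFlat M) (_ : e ∈ F.1), MvPolynomial.X F})

/-- The rational Chow ring `CH^⋆(M)` of a loopless matroid, for the maximal building set. -/
abbrev ChowRing {α : Type*} [Finite α] (M : Matroid α) : Type _ :=
  MvPolynomial (NonemptyFlat M) ℚ ⧸ chowIdeal M

/-- The graded piece `CH^k(M)`: the classes of homogeneous polynomials of degree `k`. -/
def chowPiece {α : Type*} [Finite α] (M : Matroid α) (k : ℕ) : Submodule ℚ (ChowRing M) :=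
  (MvPolynomial.homogeneousSubmodule (NonemptyFlat M) ℚ k).map
    (Ideal.Quotient.mkₐ ℚ (chowIdeal M)).toLinearMap

/-- The numerical Chow polynomial `H_n^num(t)`: it is `1` for `n = 1`, and otherwise the
Hilbert-Poincaré series of the Chow ring of the braid matroid. -/
def chowPolynomial (n : ℕ) : ℤ[X] :=
  if n = 1 then 1
  else ∑ᶠ k : ℕ, C (Module.finrank ℚ (chowPiece (braidMatroid n) k) : ℤ) * X ^ k

/-- The number `χ_n`: it is `1` for `n = 1`, and otherwise the total dimension of the Chow ring of
the braid matroid. -/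
def totalDim (n : ℕ) : ℕ :=
  if n = 1 then 1 else Module.finrank ℚ (ChowRing (braidMatroid n))

/-- The signed Stirling number of the first kind `s(n, k)`. -/
def signedStirlingFirst (n k : ℕ) : ℤ :=
  (-1) ^ (n + k) * (Nat.stirlingFirst n k : ℤ)

end BraidChow

end

noncomputable section

namespace BraidChow

/-! For a geometric lattice with rank function r, put h_F = ∑_{G ≥ F} x_G (`upSum`). In these
simplicial generators the relations of the Chow ring become (h_F - h_{F∨G})(h_G - h_{F∨G}) = 0 and
h_a = 0 for atoms a. The monomials ∏ h_{F_i}^{a_i} over chains ⊥ = F_0 < F_1 < ... with 0 < a_i <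
r(F_i) - r(F_{i-1}) (`IsNested`) form a basis.

Spanning is a straightening argument: a monomial not of this form is zero or a combination of
monomials with larger sum of ranks (`simplicialMonomial_mem_nestedSpan`). For independence, every
such chain t gets a functional with values 0 and 1 on monomials, a product of Hall-Rado conditions
over the steps of t (`staircase`). It vanishes on the ideal (`staircase_quadric`, `staircase_atom`),
and pairing functionals with monomials gives a matrix that is unitriangular for the sum of ranks
(`weight_le_of_staircase_ne_zero`).

Counting the basis by the first flat of the chain gives a recursion for the Hilbert series
(`nestedPolynomial_eq`). The flats of B_n are the partitions of an n-set, and there are S(m, j)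
partitions with j classes above one with m classes, so H_n = 1 + ∑_{j<n} S(n,j) (t + ... +
t^{n-j-1}) H_j. Multiplication by t - 1 turns this into ∑_k S(n,k) t^{n-k} H_k = t ∑_k S(n,k) H_k +
(1 - t). Stirling inversion yields the first formula; the constant 1 - t disappears because ∑_j
s(n,j) = 0 for n ≥ 2. The second formula is the derivative of the first at t = 1, where the
coefficients become ∑_j j s(n,j) S(j,k), evaluated in `stirlingMoment_eq`. -/

/-- A rank function on a lattice whose elements are separated by the given atoms. -/
structure IsGeometricRank {L ι : Type*} [Lattice L] [OrderBot L] (r : L → ℕ) (atom : ι → L) :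
    Prop where
  bot : r ⊥ = 0
  strictMono : StrictMono r
  submodular : ∀ A B, r (A ⊔ B) + r (A ⊓ B) ≤ r A + r B
  rank_atom : ∀ i, r (atom i) = 1
  exists_atom : ∀ A B, ¬ B ≤ A → ∃ i, atom i ≤ B ∧ ¬ atom i ≤ A

/-! ### Hall-Rado conditions and the 0/1 functions attached to chains. -/

section Staircase

variable {L ι : Type*} [Lattice L]

/-- The indicator function of the principal filter of `F`. -/
def filterInd (F B : L) : ℕ := open Classical in if F ≤ B then 1 else 0

/-- The truth value of a proposition as a rational number. -/
def truth (p : Prop) : ℚ := open Classical in if p then 1 else 0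

@[simp] lemma truth_true {p : Prop} (h : p) : truth p = 1 := if_pos h

@[simp] lemma truth_false {p : Prop} (h : ¬ p) : truth p = 0 := if_neg h

lemma filterInd_of_le {F B : L} (h : F ≤ B) : filterInd F B = 1 := if_pos h

lemma filterInd_of_not_le {F B : L} (h : ¬ F ≤ B) : filterInd F B = 0 := if_neg h

lemma filterInd_congr {F G B : L} (h : F ≤ B ↔ G ≤ B) : filterInd F B = filterInd G B := by
  by_cases h' : F ≤ B
  · rw [filterInd_of_le h', filterInd_of_le (h.1 h')]
  · rw [filterInd_of_not_le h', filterInd_of_not_le (mt h.2 h')]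

lemma filterInd_le_one (F B : L) : filterInd F B ≤ 1 := by
  unfold filterInd; split_ifs <;> simp

lemma filterInd_sup_of_le_left {F G B : L} (h : F ≤ B) :
    filterInd (F ⊔ G) B = filterInd G B := filterInd_congr (by simp [h])

lemma filterInd_sup_of_le_right {F G B : L} (h : G ≤ B) :
    filterInd (F ⊔ G) B = filterInd F B := filterInd_congr (by simp [h])

/-- The condition on the counting function of a multiset which says that exactly `a` of its
members lie below `X` but not below `A`, and that these satisfy the Hall-Rado condition in
the interval `[A, X]`. -/
def HallRado (r : L → ℕ) (A X : L) (a : ℕ) (c : L → ℕ) : Prop :=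
  c X = c A + a ∧ ∀ B, A < B → B ≤ X → c B + r A < r B + c A

lemma HallRado.congr {r : L → ℕ} {A X : L} {a : ℕ} {c c' : L → ℕ} (k : ℕ) (hAX : A ≤ X)
    (h : ∀ B, A ≤ B → B ≤ X → c' B = c B + k) : HallRado r A X a c' ↔ HallRado r A X a c := by
  unfold HallRado
  rw [h X hAX le_rfl, h A le_rfl hAX]
  refine and_congr (by omega) (forall_congr' fun B => forall_congr' fun h1 => forall_congr'
    fun h2 => ?_)
  rw [h B h1.le h2]; omega

/-- If both alternatives fail, at B₁ and B₂ say, then F ≤ B₁ and G ≤ B₂ while F ⊔ G lies below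
neither, and `c` falls short of the rank bound by at most one at each. Supermodularity of `c` and
submodularity of `r` then contradict the hypothesis at B₁ ⊔ B₂, where F ⊔ G counts twice. -/
lemma HallRado.exchange [OrderBot L] {r : L → ℕ} {atom : ι → L} (hr : IsGeometricRank r atom) {c : L → ℕ}
    (hc : ∀ A B, c A + c B ≤ c (A ⊔ B) + c (A ⊓ B)) {A X F G : L} {a : ℕ}
    (hFX : F ≤ X) (hGX : G ≤ X) (hFA : ¬ F ≤ A) (hGA : ¬ G ≤ A)
    (h : HallRado r A X a (c + filterInd (F ⊔ G) + filterInd (F ⊔ G))) :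
    HallRado r A X a (c + filterInd F + filterInd (F ⊔ G)) ∨
      HallRado r A X a (c + filterInd G + filterInd (F ⊔ G)) := by
  have hKA : ¬ F ⊔ G ≤ A := fun h => hFA (le_sup_left.trans h)
  have hKX : F ⊔ G ≤ X := sup_le hFX hGX
  simp only [HallRado, Pi.add_apply, filterInd_of_le hFX, filterInd_of_le hGX,
    filterInd_of_le hKX, filterInd_of_not_le hFA, filterInd_of_not_le hGA,
    filterInd_of_not_le hKA, add_zero] at h ⊢
  refine (em _).imp (fun h' => ⟨h.1, h'⟩) (fun h1 => ⟨h.1, ?_⟩)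
  by_contra h2
  push Not at h1 h2
  obtain ⟨B₁, hA1, hX1, h1⟩ := h1
  obtain ⟨B₂, hA2, hX2, h2⟩ := h2
  have e1 := h.2 B₁ hA1 hX1
  have e2 := h.2 B₂ hA2 hX2
  have e3 := h.2 (B₁ ⊔ B₂) (hA1.trans_le le_sup_left) (sup_le hX1 hX2)
  -- The meet may be `A` itself, so only the weak inequality is available.
  have e4 : c (B₁ ⊓ B₂) + r A ≤ r (B₁ ⊓ B₂) + c A := by
    rcases (le_inf hA1.le hA2.le).eq_or_lt with h0 | h0
    · rw [← h0, add_comm]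
    · have := h.2 _ h0 (inf_le_left.trans hX1); omega
  have e5 := hr.submodular B₁ B₂
  have e6 := hc B₁ B₂
  have l1 := filterInd_le_one F B₁
  have l2 := filterInd_le_one G B₂
  have k1 : F ≤ B₁ := by
    by_contra h0
    have : ¬ F ⊔ G ≤ B₁ := fun h => h0 (le_sup_left.trans h)
    rw [filterInd_of_not_le this] at h1 e1; rw [filterInd_of_not_le h0] at h1; omega
  have k2 : G ≤ B₂ := by
    by_contra h0
    have : ¬ F ⊔ G ≤ B₂ := fun h => h0 (le_sup_right.trans h)
    rw [filterInd_of_not_le this] at h2 e2; rw [filterInd_of_not_le h0] at h2; omega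
  have k3 : F ⊔ G ≤ B₁ ⊔ B₂ := sup_le_sup k1 k2
  have m1 : filterInd (F ⊔ G) B₁ = 0 := by
    have := filterInd_le_one (F ⊔ G) B₁; rw [filterInd_of_le k1] at h1; omega
  have m2 : filterInd (F ⊔ G) B₂ = 0 := by
    have := filterInd_le_one (F ⊔ G) B₂; rw [filterInd_of_le k2] at h2; omega
  rw [filterInd_of_le k3] at e3
  rw [m1, filterInd_of_le k1] at h1
  rw [m2, filterInd_of_le k2] at h2
  omega

/-- With K = F ⊔ G and p, q the conditions for the pairs (F, K), (G, K), the pair (F, G) satisfies p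
∧ q and the pair (K, K) satisfies p ∨ q. The identity is inclusion-exclusion for truth values; only
the step from (K, K) to p ∨ q needs the exchange property. -/
lemma HallRado.quadric [OrderBot L] {r : L → ℕ} {atom : ι → L} (hr : IsGeometricRank r atom) {c : L → ℕ}
    (hc : ∀ A B, c A + c B ≤ c (A ⊔ B) + c (A ⊓ B)) {A X F G : L} {a : ℕ}
    (hFX : F ≤ X) (hGX : G ≤ X) (hFA : ¬ F ≤ A) (hGA : ¬ G ≤ A) :
    truth (HallRado r A X a (c + filterInd F + filterInd G)) +
      truth (HallRado r A X a (c + filterInd (F ⊔ G) + filterInd (F ⊔ G))) =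
    truth (HallRado r A X a (c + filterInd F + filterInd (F ⊔ G))) +
      truth (HallRado r A X a (c + filterInd G + filterInd (F ⊔ G))) := by
  have hex := HallRado.exchange hr (a := a) hc hFX hGX hFA hGA
  have hKA : ¬ F ⊔ G ≤ A := fun h => hFA (le_sup_left.trans h)
  have hKX : F ⊔ G ≤ X := sup_le hFX hGX
  have hF : ∀ B, filterInd (F ⊔ G) B ≤ filterInd F B := fun B => by
    by_cases h : F ⊔ G ≤ B
    · rw [filterInd_of_le h, filterInd_of_le (le_sup_left.trans h)]
    · rw [filterInd_of_not_le h]; exact Nat.zero_le _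
  have hG : ∀ B, filterInd (F ⊔ G) B ≤ filterInd G B := fun B => by
    by_cases h : F ⊔ G ≤ B
    · rw [filterInd_of_le h, filterInd_of_le (le_sup_right.trans h)]
    · rw [filterInd_of_not_le h]; exact Nat.zero_le _
  have h3 : HallRado r A X a (c + filterInd F + filterInd (F ⊔ G)) →
      HallRado r A X a (c + filterInd G + filterInd (F ⊔ G)) →
      HallRado r A X a (c + filterInd F + filterInd G) := by
    simp only [HallRado, Pi.add_apply, filterInd_of_le hFX, filterInd_of_le hGX,
      filterInd_of_le hKX, filterInd_of_not_le hFA, filterInd_of_not_le hGA,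
      filterInd_of_not_le hKA, add_zero]
    intro h1 h2
    refine ⟨h1.1, fun B hB hBX => ?_⟩
    have e1 := h1.2 B hB hBX
    have e2 := h2.2 B hB hBX
    by_cases hFB : F ≤ B
    · by_cases hGB : G ≤ B
      · rw [filterInd_of_le (sup_le hFB hGB)] at e1; rwa [filterInd_of_le hGB]
      · rw [filterInd_of_not_le hGB]; omega
    · rw [filterInd_of_not_le hFB]; omega
  have h1 : HallRado r A X a (c + filterInd F + filterInd G) →
      HallRado r A X a (c + filterInd F + filterInd (F ⊔ G)) ∧
      HallRado r A X a (c + filterInd G + filterInd (F ⊔ G)) := by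
    simp only [HallRado, Pi.add_apply, filterInd_of_le hFX, filterInd_of_le hGX,
      filterInd_of_le hKX, filterInd_of_not_le hFA, filterInd_of_not_le hGA,
      filterInd_of_not_le hKA, add_zero]
    intro h
    refine ⟨⟨h.1, fun B hB hBX => ?_⟩, ⟨h.1, fun B hB hBX => ?_⟩⟩ <;>
    · have := h.2 B hB hBX; have := hF B; have := hG B; omega
  have h2 : HallRado r A X a (c + filterInd F + filterInd (F ⊔ G)) ∨
      HallRado r A X a (c + filterInd G + filterInd (F ⊔ G)) →
      HallRado r A X a (c + filterInd (F ⊔ G) + filterInd (F ⊔ G)) := by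
    simp only [HallRado, Pi.add_apply, filterInd_of_le hFX, filterInd_of_le hGX,
      filterInd_of_le hKX, filterInd_of_not_le hFA, filterInd_of_not_le hGA,
      filterInd_of_not_le hKA, add_zero]
    rintro (h | h) <;> refine ⟨h.1, fun B hB hBX => ?_⟩ <;>
    · have := h.2 B hB hBX; have := hF B; have := hG B; omega
  by_cases p : HallRado r A X a (c + filterInd F + filterInd (F ⊔ G)) <;>
  by_cases q : HallRado r A X a (c + filterInd G + filterInd (F ⊔ G))
  · simp [p, q, h3 p q, h2 (Or.inl p)]
  · have : ¬ HallRado r A X a (c + filterInd F + filterInd G) := fun h => q (h1 h).2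
    simp [p, q, this, h2 (Or.inl p)]
  · have : ¬ HallRado r A X a (c + filterInd F + filterInd G) := fun h => p (h1 h).1
    simp [p, q, this, h2 (Or.inr q)]
  · have : ¬ HallRado r A X a (c + filterInd F + filterInd G) := fun h => p (h1 h).1
    have h' : ¬ HallRado r A X a (c + filterInd (F ⊔ G) + filterInd (F ⊔ G)) := fun h =>
      (hex h).elim p q
    simp [p, q, this, h']

variable [BoundedOrder L]

/-- The product of the Hall-Rado conditions in the successive intervals of a chain. -/
def staircase (r : L → ℕ) : L → List (L × ℕ) → (L → ℕ) → ℚ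
  | A, [], c => truth (c ⊤ = c A)
  | A, (X, a) :: t, c =>
    truth (HallRado r A X a c) * staircase r X t c

/-- The exponent data of the monomials of Feichtner and Yuzvinsky in the interval `[A, ⊤]`. -/
def IsNested (r : L → ℕ) : L → List (L × ℕ) → Prop
  | _, [] => True
  | A, (X, a) :: t => A < X ∧ 0 < a ∧ a + r A < r X ∧ IsNested r X t

/-- Only differences of the counting function above `A` matter, so members lying below `A` may be
added or dropped. -/
lemma staircase_congr {r : L → ℕ} {c c' : L → ℕ} (k : ℕ) :
    ∀ {A : L} {t : List (L × ℕ)}, IsNested r A t → (∀ B, A ≤ B → c' B = c B + k) →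
      staircase r A t c' = staircase r A t c
  | A, [], _, h => by
    simp only [staircase, h ⊤ le_top, h A le_rfl, add_left_inj]
  | A, (X, a) :: t, ht, h => by
    simp only [staircase]
    rw [staircase_congr k ht.2.2.2 fun B hB => h B (ht.1.le.trans hB)]
    simp only [HallRado.congr k ht.1.le fun B h1 _ => h B h1]

/-- If F and G lie below `X`, the tail does not see them and the head is `HallRado.quadric`, or a
cancellation if one of them lies below `A`. If just one lies below `X`, the other and F ⊔ G are both
invisible in the head and indistinguishable in the tail, so the terms cancel in pairs. Otherwise the
head is unaffected and the recursion applies. -/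
lemma staircase_quadric {r : L → ℕ} {atom : ι → L} (hr : IsGeometricRank r atom) {c : L → ℕ}
    (hm : Monotone c) (hc : ∀ A B, c A + c B ≤ c (A ⊔ B) + c (A ⊓ B)) (F G : L) :
    ∀ {A : L} {t : List (L × ℕ)}, IsNested r A t →
      staircase r A t (c + filterInd F + filterInd G) +
        staircase r A t (c + filterInd (F ⊔ G) + filterInd (F ⊔ G)) =
      staircase r A t (c + filterInd F + filterInd (F ⊔ G)) +
        staircase r A t (c + filterInd G + filterInd (F ⊔ G))
  | A, [], _ => by
    have h0 : c A ≤ c ⊤ := hm le_top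
    simp only [staircase, Pi.add_apply, filterInd_of_le le_top]
    by_cases hF : F ≤ A <;> by_cases hG : G ≤ A
    · simp [filterInd_of_le hF, filterInd_of_le hG, filterInd_of_le (sup_le hF hG)]
    · have hK : ¬ F ⊔ G ≤ A := fun h => hG (le_sup_right.trans h)
      rw [filterInd_of_le hF, filterInd_of_not_le hG, filterInd_of_not_le hK, truth_false (by omega),
        truth_false (by omega)]
    · have hK : ¬ F ⊔ G ≤ A := fun h => hF (le_sup_left.trans h)
      rw [filterInd_of_le hG, filterInd_of_not_le hF, filterInd_of_not_le hK, truth_false (by omega),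
        truth_false (by omega)]
    · have hK : ¬ F ⊔ G ≤ A := fun h => hF (le_sup_left.trans h)
      rw [filterInd_of_not_le hF, filterInd_of_not_le hG, filterInd_of_not_le hK]
  | A, (X, a) :: t, ht => by
    simp only [staircase]
    have ht' := ht.2.2.2
    have hAX := ht.1.le
    by_cases hF : F ≤ X <;> by_cases hG : G ≤ X
    · have key : ∀ P Q : L, P ≤ X → Q ≤ X →
          staircase r X t (c + filterInd P + filterInd Q) = staircase r X t c :=
        fun P Q hP hQ => staircase_congr 2 ht' fun B hB => by
          simp [filterInd_of_le (hP.trans hB), filterInd_of_le (hQ.trans hB)]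
      rw [key F G hF hG, key F _ hF (sup_le hF hG), key G _ hG (sup_le hF hG),
        key _ _ (sup_le hF hG) (sup_le hF hG), ← add_mul, ← add_mul]
      congr 1
      by_cases hFA : F ≤ A
      · have e1 := HallRado.congr (r := r) (a := a) (c' := c + filterInd F + filterInd G)
          (c := c + filterInd F + filterInd (F ⊔ G)) 0 hAX fun B hB _ => by
            simp [filterInd_sup_of_le_left (G := G) (hFA.trans hB)]
        have e2 := HallRado.congr (r := r) (a := a) (c' := c + filterInd G + filterInd (F ⊔ G))
          (c := c + filterInd (F ⊔ G) + filterInd (F ⊔ G)) 0 hAX fun B hB _ => by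
            simp [filterInd_sup_of_le_left (G := G) (hFA.trans hB)]
        simp only [e1, e2]
      · by_cases hGA : G ≤ A
        · have e1 := HallRado.congr (r := r) (a := a) (c' := c + filterInd F + filterInd G)
            (c := c + filterInd G + filterInd (F ⊔ G)) 0 hAX fun B hB _ => by
              simp [filterInd_sup_of_le_right (F := F) (hGA.trans hB)]; ring
          have e2 := HallRado.congr (r := r) (a := a) (c' := c + filterInd F + filterInd (F ⊔ G))
            (c := c + filterInd (F ⊔ G) + filterInd (F ⊔ G)) 0 hAX fun B hB _ => by
              simp [filterInd_sup_of_le_right (F := F) (hGA.trans hB)]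
          simp only [e1, e2]
          ring
        · exact HallRado.quadric hr hc hF hG hFA hGA
    · have hK : ¬ F ⊔ G ≤ X := fun h => hG (le_sup_right.trans h)
      have e1 := HallRado.congr (r := r) (a := a) (c' := c + filterInd F + filterInd G)
          (c := c + filterInd F + filterInd (F ⊔ G)) 0 hAX fun B _ hB => by
            simp [filterInd_of_not_le fun h => hG (h.trans hB),
              filterInd_of_not_le fun h => hK (h.trans hB)]
      have e2 := HallRado.congr (r := r) (a := a) (c' := c + filterInd G + filterInd (F ⊔ G))
          (c := c + filterInd (F ⊔ G) + filterInd (F ⊔ G)) 0 hAX fun B _ hB => by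
            simp [filterInd_of_not_le fun h => hG (h.trans hB),
              filterInd_of_not_le fun h => hK (h.trans hB)]
      have e3 := staircase_congr (c' := c + filterInd F + filterInd G)
          (c := c + filterInd F + filterInd (F ⊔ G)) 0 ht' fun B hB => by
            simp [filterInd_sup_of_le_left (G := G) (hF.trans hB)]
      have e4 := staircase_congr (c' := c + filterInd G + filterInd (F ⊔ G))
          (c := c + filterInd (F ⊔ G) + filterInd (F ⊔ G)) 0 ht' fun B hB => by
            simp [filterInd_sup_of_le_left (G := G) (hF.trans hB)]
      simp only [e1, e2, e3, e4]
    · have hK : ¬ F ⊔ G ≤ X := fun h => hF (le_sup_left.trans h)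
      have e1 := HallRado.congr (r := r) (a := a) (c' := c + filterInd F + filterInd G)
          (c := c + filterInd G + filterInd (F ⊔ G)) 0 hAX fun B _ hB => by
            simp [filterInd_of_not_le fun h => hF (h.trans hB),
              filterInd_of_not_le fun h => hK (h.trans hB)]
      have e2 := HallRado.congr (r := r) (a := a) (c' := c + filterInd F + filterInd (F ⊔ G))
          (c := c + filterInd (F ⊔ G) + filterInd (F ⊔ G)) 0 hAX fun B _ hB => by
            simp [filterInd_of_not_le fun h => hF (h.trans hB),
              filterInd_of_not_le fun h => hK (h.trans hB)]
      have e3 := staircase_congr (c' := c + filterInd F + filterInd G)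
          (c := c + filterInd G + filterInd (F ⊔ G)) 0 ht' fun B hB => by
            simp [filterInd_sup_of_le_right (F := F) (hG.trans hB)]; ring
      have e4 := staircase_congr (c' := c + filterInd F + filterInd (F ⊔ G))
          (c := c + filterInd (F ⊔ G) + filterInd (F ⊔ G)) 0 ht' fun B hB => by
            simp [filterInd_sup_of_le_right (F := F) (hG.trans hB)]
      simp only [e1, e2, e3, e4]
      ring
    · have hK : ¬ F ⊔ G ≤ X := fun h => hG (le_sup_right.trans h)
      have key : ∀ P Q : L, ¬ P ≤ X → ¬ Q ≤ X →
          (HallRado r A X a (c + filterInd P + filterInd Q) ↔ HallRado r A X a c) :=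
        fun P Q hP hQ => HallRado.congr 0 hAX fun B _ hB => by
          simp [filterInd_of_not_le fun h => hP (h.trans hB),
            filterInd_of_not_le fun h => hQ (h.trans hB)]
      simp only [key F G hF hG, key F _ hF hK, key G _ hG hK, key _ _ hK hK, ← mul_add]
      rw [staircase_quadric hr hm hc F G ht']

/-- In the step where the atom is first absorbed, the join of the atom with the lower end raises the
rank by at most one and already contains one new member, which violates the strict inequality. -/
lemma staircase_atom {r : L → ℕ} {atom : ι → L} (hr : IsGeometricRank r atom) {c : L → ℕ}
    (hm : Monotone c) (i : ι) :
    ∀ {A : L} {t : List (L × ℕ)}, IsNested r A t → ¬ atom i ≤ A →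
      staircase r A t (c + filterInd (atom i)) = 0
  | A, [], _, hA => by
    have h0 : c A ≤ c ⊤ := hm le_top
    simp only [staircase, Pi.add_apply, filterInd_of_le le_top, filterInd_of_not_le hA]
    rw [truth_false (by omega)]
  | A, (X, a) :: t, ht, hA => by
    simp only [staircase]
    by_cases hX : atom i ≤ X
    · rw [truth_false, zero_mul]
      rintro ⟨-, h⟩
      have := h (A ⊔ atom i) (left_lt_sup.2 hA) (sup_le ht.1.le hX)
      rw [Pi.add_apply, Pi.add_apply, filterInd_of_le le_sup_right, filterInd_of_not_le hA] at this
      have h1 := hr.submodular A (atom i)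
      rw [hr.rank_atom] at h1
      have h2 : c A ≤ c (A ⊔ atom i) := hm le_sup_left
      omega
    · rw [staircase_atom hr hm i ht.2.2.2 hX, mul_zero]

end Staircase

/-! ### Möbius inversion between the variables and the simplicial generators. -/

section UpSum

variable {P R : Type*} [PartialOrder P] [Fintype P] [CommRing R]

open Classical in
/-- The sum of the values of `x` on the principal filter of `F`. -/
def upSum (x : P → R) (F : P) : R := ∑ G with F ≤ G, x G

open Classical in
lemma upSum_sub (x : P → R) {F G K : P} (hK : ∀ A, K ≤ A ↔ F ≤ A ∧ G ≤ A) :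
    upSum x F - upSum x K = ∑ A with F ≤ A ∧ ¬ G ≤ A, x A := by
  unfold upSum
  rw [sub_eq_iff_eq_add, ← Finset.sum_filter_add_sum_filter_not _ (fun A => G ≤ A), add_comm]
  simp only [Finset.filter_filter, hK]

open Classical in
lemma upSum_eq_add (x : P → R) (F : P) : upSum x F = x F + ∑ G with F < G, x G := by
  unfold upSum
  rw [← Finset.sum_filter_add_sum_filter_not _ (fun A => A = F)]
  simp only [Finset.filter_filter]
  congr 1
  · rw [show (Finset.univ.filter fun A => F ≤ A ∧ A = F) = {F} by
      ext; simp +contextual, Finset.sum_singleton]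
  · refine Finset.sum_congr (Finset.filter_congr fun G _ => ?_) fun _ _ => rfl
    rw [lt_iff_le_and_ne, ne_comm]

lemma exists_upSum_eq (f : P → R) : ∃ x : P → R, upSum x = f := by
  classical
  let x : P → R := (wellFounded_gt (α := P)).fix fun F ih =>
    f F - ∑ G : {G // F < G}, ih G.1 G.2
  refine ⟨x, funext fun F => ?_⟩
  have : x F = f F - ∑ G : {G // F < G}, x G.1 := WellFounded.fix_eq _ _ F
  rw [upSum_eq_add, this, Finset.sum_subtype (p := fun G => F < G)]
  · ring
  · simp

lemma eq_of_upSum_eq {x y : P → R} (h : upSum x = upSum y) : x = y := by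
  classical
  funext F
  induction F using (wellFounded_gt (α := P)).induction with
  | _ F ih =>
    have h1 := congrFun h F
    rw [upSum_eq_add, upSum_eq_add, Finset.sum_congr rfl fun G hG => ih G (by simpa using hG)] at h1
    exact add_right_cancel h1

/-- The two factors are sums over the A with F ≤ A, ¬ G ≤ A and over the B with G ≤ B, ¬ F ≤ B; such
A and B are incomparable. -/
lemma upSum_mul_eq_zero {x : P → R} (hx : ∀ F G, ¬ F ≤ G → ¬ G ≤ F → x F * x G = 0)
    {F G K : P} (hK : ∀ A, K ≤ A ↔ F ≤ A ∧ G ≤ A) :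
    (upSum x F - upSum x K) * (upSum x G - upSum x K) = 0 := by
  rw [upSum_sub x hK, upSum_sub x fun A => (hK A).trans and_comm, Finset.sum_mul_sum]
  refine Finset.sum_eq_zero fun A hA => Finset.sum_eq_zero fun B hB => ?_
  simp only [Finset.mem_filter, Finset.mem_univ, true_and] at hA hB
  exact hx A B (fun h => hB.2 (hA.1.trans h)) fun h => hA.2 (hB.1.trans h)

/-- Converse of the previous relation, by downward induction on pairs: expanding the quadric gives
`x F * x G` plus products over strictly larger incomparable pairs. -/
lemma mul_mem_of_upSum_mul_mem {x : P → R} {I : Ideal R} (sup : P → P → P)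
    (hsup : ∀ F G A, sup F G ≤ A ↔ F ≤ A ∧ G ≤ A)
    (hI : ∀ F G, (upSum x F - upSum x (sup F G)) * (upSum x G - upSum x (sup F G)) ∈ I)
    {F G : P} (hFG : ¬ F ≤ G) (hGF : ¬ G ≤ F) : x F * x G ∈ I := by
  classical
  suffices ∀ p : P × P, ¬ p.1 ≤ p.2 → ¬ p.2 ≤ p.1 → x p.1 * x p.2 ∈ I from this (F, G) hFG hGF
  intro p
  induction p using (wellFounded_gt (α := P × P)).induction with
  | _ p ih =>
    intro h1 h2
    have h := hI p.1 p.2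
    rw [upSum_sub x (hsup p.1 p.2), upSum_sub x fun A => (hsup p.1 p.2 A).trans and_comm,
      Finset.sum_mul_sum, ← Finset.sum_product'] at h
    rw [← Finset.add_sum_erase _ _ (a := p) (by simp [h1, h2])] at h
    refine (Ideal.add_mem_iff_left I (Ideal.sum_mem I fun q hq => ?_)).1 h
    simp only [Finset.mem_erase, Finset.mem_product, Finset.mem_filter, Finset.mem_univ,
      true_and] at hq
    refine ih q (lt_of_le_of_ne ⟨hq.2.1.1, hq.2.2.1⟩ (Ne.symm hq.1)) (fun h => ?_) fun h => ?_
    · exact hq.2.2.2 (hq.2.1.1.trans h)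
    · exact hq.2.1.2 (hq.2.2.1.trans h)

end UpSum

/-! ### Multisets of flats, their counting functions and rank sums. -/

section Counting

variable {L ι : Type*} [Lattice L] [BoundedOrder L]

/-- The elements of a lattice other than the bottom one. -/
abbrev NonBot (L : Type*) [Lattice L] [BoundedOrder L] : Type _ := {F : L // F ≠ ⊥}

/-- The join of two elements other than the bottom one. -/
def nonBotSup (F G : NonBot L) : NonBot L :=
  ⟨F.1 ⊔ G.1, fun h => F.2 (sup_eq_bot_iff.1 h).1⟩

lemma nonBotSup_le (F G A : NonBot L) : nonBotSup F G ≤ A ↔ F ≤ A ∧ G ≤ A := sup_le_iff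

/-- The number of members below `B` of the multiset with multiplicities `m`. -/
def countBelow (m : NonBot L →₀ ℕ) (B : L) : ℕ := m.sum fun F k => k * filterInd F.1 B

/-- The sum of the ranks of the members of the multiset with multiplicities `m`. -/
def weight (r : L → ℕ) (m : NonBot L →₀ ℕ) : ℕ := m.sum fun F k => k * r F.1

lemma countBelow_zero : countBelow (0 : NonBot L →₀ ℕ) = 0 := by
  funext B; simp [countBelow]

lemma countBelow_add (m m' : NonBot L →₀ ℕ) :
    countBelow (m + m') = countBelow m + countBelow m' := by
  funext B
  exact Finsupp.sum_add_index' (by simp) (by intros; ring)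

lemma countBelow_single (F : NonBot L) (k : ℕ) (B : L) :
    countBelow (Finsupp.single F k) B = k * filterInd F.1 B :=
  Finsupp.sum_single_index (by simp)

lemma countBelow_single_one (F : NonBot L) :
    countBelow (Finsupp.single F 1) = filterInd F.1 := by
  funext B; rw [countBelow_single, one_mul]

lemma weight_add (r : L → ℕ) (m m' : NonBot L →₀ ℕ) :
    weight r (m + m') = weight r m + weight r m' :=
  Finsupp.sum_add_index' (by simp) (by intros; ring)

lemma weight_single (r : L → ℕ) (F : NonBot L) (k : ℕ) :
    weight r (Finsupp.single F k) = k * r F.1 :=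
  Finsupp.sum_single_index (by simp)

lemma countBelow_mono (m : NonBot L →₀ ℕ) : Monotone (countBelow m) := fun A B h => by
  refine Finset.sum_le_sum fun F _ => Nat.mul_le_mul_left _ ?_
  by_cases hF : F.1 ≤ A
  · rw [filterInd_of_le hF, filterInd_of_le (hF.trans h)]
  · rw [filterInd_of_not_le hF]; exact Nat.zero_le _

lemma countBelow_supermodular (m : NonBot L →₀ ℕ) (A B : L) :
    countBelow m A + countBelow m B ≤ countBelow m (A ⊔ B) + countBelow m (A ⊓ B) := by
  simp only [countBelow, Finsupp.sum, ← Finset.sum_add_distrib, ← mul_add]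
  refine Finset.sum_le_sum fun F _ => Nat.mul_le_mul_left _ ?_
  by_cases hA : F.1 ≤ A
  · have h1 := filterInd_of_le (hA.trans (le_sup_left (b := B)))
    by_cases hB : F.1 ≤ B
    · rw [h1, filterInd_of_le hA, filterInd_of_le hB, filterInd_of_le (le_inf hA hB)]
    · rw [h1, filterInd_of_le hA, filterInd_of_not_le hB]; omega
  · by_cases hB : F.1 ≤ B
    · rw [filterInd_of_le hB, filterInd_of_not_le hA,
        filterInd_of_le (hB.trans (le_sup_right (a := A)))]; omega
    · rw [filterInd_of_not_le hA, filterInd_of_not_le hB]; omega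

lemma countBelow_eq_zero {m : NonBot L →₀ ℕ} {B : L} (h : ∀ F ∈ m.support, ¬ F.1 ≤ B) :
    countBelow m B = 0 :=
  Finset.sum_eq_zero fun F hF => by simp [filterInd_of_not_le (h F hF)]

lemma countBelow_eq_degree {m : NonBot L →₀ ℕ} {B : L} (h : ∀ F ∈ m.support, F.1 ≤ B) :
    countBelow m B = m.degree := by
  rw [Finsupp.degree_apply]
  exact Finset.sum_congr rfl fun F hF => by simp [filterInd_of_le (h F hF)]

open Classical in
/-- The multiset of flats encoded by a list of flats with multiplicities. -/
def listMonomial : List (L × ℕ) → (NonBot L →₀ ℕ)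
  | [] => 0
  | (X, a) :: t => (if h : X ≠ ⊥ then Finsupp.single ⟨X, h⟩ a else 0) + listMonomial t

lemma listMonomial_cons {X : L} (h : X ≠ ⊥) (a : ℕ) (t : List (L × ℕ)) :
    listMonomial ((X, a) :: t) = Finsupp.single ⟨X, h⟩ a + listMonomial t := by
  rw [listMonomial, dif_pos h]

/-- The sum of the multiplicities in a list. -/
def listDegree (t : List (L × ℕ)) : ℕ := (t.map Prod.snd).sum

lemma degree_listMonomial {r : L → ℕ} :
    ∀ {A : L} {t : List (L × ℕ)}, IsNested r A t → (listMonomial t).degree = listDegree t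
  | _, [], _ => by simp [listMonomial, listDegree]
  | _, (X, a) :: t, ht => by
    rw [listMonomial_cons ht.1.ne_bot, map_add, degree_listMonomial ht.2.2.2]
    simp [listDegree]

lemma countBelow_listMonomial_eq_zero {r : L → ℕ} {B : L} :
    ∀ {A : L} {t : List (L × ℕ)}, IsNested r A t → B ≤ A → countBelow (listMonomial t) B = 0
  | _, [], _, _ => by simp [listMonomial, countBelow]
  | A, (X, a) :: t, ht, hB => by
    rw [listMonomial_cons ht.1.ne_bot, countBelow_add, Pi.add_apply, countBelow_single,
      countBelow_listMonomial_eq_zero ht.2.2.2 (hB.trans ht.1.le),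
      filterInd_of_not_le fun h => (ht.1.trans_le (h.trans hB)).false, mul_zero]

lemma le_of_countBelow_listMonomial_ne_zero {r : L → ℕ} {B : L} :
    ∀ {A : L} {t : List (L × ℕ)}, IsNested r A t → countBelow (listMonomial t) B ≠ 0 → A ≤ B
  | _, [], _, h => by simp [listMonomial, countBelow] at h
  | A, (X, a) :: t, ht, h => by
    rw [listMonomial_cons ht.1.ne_bot, countBelow_add, Pi.add_apply, countBelow_single] at h
    by_cases hX : X ≤ B
    · exact ht.1.le.trans hX
    · rw [filterInd_of_not_le hX, mul_zero, zero_add] at h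
      exact ht.1.le.trans (le_of_countBelow_listMonomial_ne_zero ht.2.2.2 h)

lemma countBelow_listMonomial_cons_self {r : L → ℕ} {A X : L} {a : ℕ} {t : List (L × ℕ)}
    (ht : IsNested r A ((X, a) :: t)) : countBelow (listMonomial ((X, a) :: t)) X = a := by
  rw [listMonomial_cons ht.1.ne_bot, countBelow_add, Pi.add_apply, countBelow_single,
    countBelow_listMonomial_eq_zero ht.2.2.2 le_rfl, filterInd_of_le le_rfl]
  simp

lemma le_of_countBelow_listMonomial_cons_ne_zero {r : L → ℕ} {A X B : L} {a : ℕ}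
    {t : List (L × ℕ)} (ht : IsNested r A ((X, a) :: t))
    (h : countBelow (listMonomial ((X, a) :: t)) B ≠ 0) : X ≤ B := by
  by_contra hX
  rw [listMonomial_cons ht.1.ne_bot, countBelow_add, Pi.add_apply, countBelow_single,
    filterInd_of_not_le hX, mul_zero, zero_add] at h
  exact hX (le_of_countBelow_listMonomial_ne_zero ht.2.2.2 h)

/-- The first flat is recovered as the least one with a nonzero count, and its exponent is that
count. -/
lemma listMonomial_injective {r : L → ℕ} :
    ∀ {A : L} {t t' : List (L × ℕ)}, IsNested r A t → IsNested r A t' →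
      listMonomial t = listMonomial t' → t = t'
  | _, [], [], _, _, _ => rfl
  | _, [], (X, a) :: t, _, ht, h => by
    have := countBelow_listMonomial_cons_self ht
    rw [← h] at this
    simp only [listMonomial, countBelow_zero, Pi.zero_apply] at this
    exact absurd ht.2.1 (by omega)
  | _, (X, a) :: t, [], ht, _, h => by
    have := countBelow_listMonomial_cons_self ht
    rw [h] at this
    simp only [listMonomial, countBelow_zero, Pi.zero_apply] at this
    exact absurd ht.2.1 (by omega)
  | A, (X, a) :: t, (X', a') :: t', ht, ht', h => by
    have e := countBelow_listMonomial_cons_self ht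
    have e' := countBelow_listMonomial_cons_self ht'
    have h1 := ht.2.1
    have h2 := ht'.2.1
    have hX : X = X' := le_antisymm
      (le_of_countBelow_listMonomial_cons_ne_zero ht (by rw [h]; omega))
      (le_of_countBelow_listMonomial_cons_ne_zero ht' (by rw [← h]; omega))
    subst hX
    have ha : a = a' := by rw [← e, h, e']
    subst ha
    rw [listMonomial_cons ht.1.ne_bot, listMonomial_cons ht.1.ne_bot] at h
    rw [listMonomial_injective ht.2.2.2 ht'.2.2.2 (add_left_cancel h)]

lemma staircase_listMonomial {r : L → ℕ} (hr : StrictMono r) :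
    ∀ {A : L} {t : List (L × ℕ)}, IsNested r A t →
      staircase r A t (countBelow (listMonomial t)) = 1
  | A, [], _ => by simp [staircase, listMonomial, countBelow]
  | A, (X, a) :: t, ht => by
    rw [staircase, truth_true, one_mul,
      staircase_congr (c := countBelow (listMonomial t)) a ht.2.2.2 fun B hB => ?_,
      staircase_listMonomial hr ht.2.2.2]
    · rw [listMonomial_cons ht.1.ne_bot, countBelow_add, Pi.add_apply, countBelow_single,
        filterInd_of_le hB]; ring
    · rw [HallRado, countBelow_listMonomial_cons_self ht,
        countBelow_listMonomial_eq_zero ht le_rfl]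
      refine ⟨by simp, fun B hA hB => ?_⟩
      rw [listMonomial_cons ht.1.ne_bot, countBelow_add, Pi.add_apply, countBelow_single,
        countBelow_listMonomial_eq_zero ht.2.2.2 hB]
      rcases hB.eq_or_lt with rfl | h
      · have := ht.2.2.1
        rw [filterInd_of_le le_rfl]; omega
      · rw [filterInd_of_not_le h.not_ge]
        have := hr hA
        omega

/-- A nonzero value forces exactly `a` members of `m` below `X`. Their ranks sum to at most `a * r
X`, with equality only if all of them equal `X`; the remaining members are handled by the tail. -/
lemma weight_le_of_staircase_ne_zero {r : L → ℕ} (hr : StrictMono r) :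
    ∀ {A : L} {t : List (L × ℕ)}, IsNested r A t → ∀ m : NonBot L →₀ ℕ,
      (∀ F ∈ m.support, ¬ F.1 ≤ A) → staircase r A t (countBelow m) ≠ 0 →
      weight r m ≤ weight r (listMonomial t) ∧
        (weight r m = weight r (listMonomial t) → m = listMonomial t)
  | A, [], _, m, hm, h => by
    rw [staircase, countBelow_eq_zero hm, countBelow_eq_degree fun F _ => le_top] at h
    have : m = 0 := by
      by_contra h0
      exact h (truth_false fun h1 => h0 ((Finsupp.degree_eq_zero_iff m).1 h1))
    simp [this, listMonomial]
  | A, (X, a) :: t, ht, m, hm, h => by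
    classical
    obtain ⟨h1, h2⟩ := mul_ne_zero_iff.1 h
    have h1 : HallRado r A X a (countBelow m) := by
      by_contra h0; exact h1 (truth_false h0)
    have hsplit := Finsupp.filter_add_filter_not m (fun F : NonBot L => F.1 ≤ X)
    set m₁ := m.filter (fun F : NonBot L => F.1 ≤ X)
    set m₂ := m.filter (fun F : NonBot L => ¬ F.1 ≤ X)
    have hm₁ : ∀ F ∈ m₁.support, F.1 ≤ X := fun F hF => by
      simp only [m₁, Finsupp.support_filter, Finset.mem_filter] at hF; exact hF.2
    have hm₂ : ∀ F ∈ m₂.support, ¬ F.1 ≤ X := fun F hF => by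
      simp only [m₂, Finsupp.support_filter, Finset.mem_filter] at hF; exact hF.2
    have hdeg : m₁.degree = a := by
      have h3 := h1.1
      rw [countBelow_eq_zero hm, ← hsplit, countBelow_add, Pi.add_apply,
        countBelow_eq_zero hm₂, countBelow_eq_degree hm₁] at h3
      omega
    rw [← hsplit, staircase_congr (c := countBelow m₂) a ht.2.2.2 fun B hB => ?_] at h2
    swap
    · rw [countBelow_add, Pi.add_apply, countBelow_eq_degree fun F hF => (hm₁ F hF).trans hB, hdeg,
        add_comm]
    obtain ⟨ih1, ih2⟩ := weight_le_of_staircase_ne_zero hr ht.2.2.2 m₂ hm₂ h2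
    have hle : ∀ F ∈ m₁.support, m₁ F * r F.1 ≤ m₁ F * r X := fun F hF =>
      Nat.mul_le_mul_left _ (hr.monotone (hm₁ F hF))
    have hsum : ∑ F ∈ m₁.support, m₁ F * r X = a * r X := by
      rw [← Finset.sum_mul, ← hdeg, Finsupp.degree_apply]
    have hw1 : weight r m₁ ≤ a * r X := hsum ▸ Finset.sum_le_sum hle
    rw [listMonomial_cons ht.1.ne_bot, ← hsplit, weight_add, weight_add, weight_single]
    refine ⟨add_le_add hw1 ih1, fun heq => ?_⟩
    have hw1' : weight r m₁ = a * r X := by dsimp only at heq; omega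
    rw [ih2 (by dsimp only at heq; omega)]
    congr 1
    have hall := (Finset.sum_eq_sum_iff_of_le hle).1 (hw1'.trans hsum.symm)
    have hX : ∀ F ∈ m₁.support, F = ⟨X, ht.1.ne_bot⟩ := fun F hF => by
      have h4 := Nat.eq_of_mul_eq_mul_left
        (Nat.pos_of_ne_zero (Finsupp.mem_support_iff.1 hF)) (hall F hF)
      by_contra hne
      exact (hr ((hm₁ F hF).lt_of_ne fun h => hne (Subtype.ext h))).ne h4
    have h5 : m₁ = Finsupp.single ⟨X, ht.1.ne_bot⟩ (m₁ ⟨X, ht.1.ne_bot⟩) :=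
      Finsupp.support_subset_singleton.1 fun F hF => Finset.mem_singleton.2 (hX F hF)
    have h6 := hdeg
    rw [h5, Finsupp.degree_single] at h6
    rw [h5, h6]

end Counting

/-- In a relation, the functional belonging to a term of least weight kills all the other terms. -/
lemma linearIndependent_of_triangular {K V ι : Type*} [Field K] [AddCommGroup V] [Module K V]
    {v : ι → V} (φ : ι → V →ₗ[K] K) (w : ι → ℕ) (h1 : ∀ i, φ i (v i) = 1)
    (h2 : ∀ i j, φ i (v j) ≠ 0 → i ≠ j → w j < w i) : LinearIndependent K v := by
  classical
  rw [linearIndependent_iff']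
  intro s g hg
  by_contra! hne
  obtain ⟨i, hi, hmin⟩ := Finset.exists_min_image (s.filter fun i => g i ≠ 0) w
    (by obtain ⟨i, hi, h⟩ := hne; exact ⟨i, by simp [hi, h]⟩)
  simp only [Finset.mem_filter] at hi hmin
  have := congrArg (φ i) hg
  rw [map_sum, map_zero, Finset.sum_eq_single i] at this
  · simp [h1, hi.2] at this
  · intro j hj hji
    by_contra h
    rw [map_smul, smul_eq_mul] at h
    have hj' := mul_ne_zero_iff.1 h
    exact (h2 i j hj'.2 hji.symm).not_ge (hmin j ⟨hj, hj'.1⟩)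
  · exact fun h => absurd hi.1 h

/-! ### Functionals on the Chow ring and linear independence of the basis monomials. -/

section Functional

variable {L ι : Type*} [Lattice L] [BoundedOrder L]

/-- The linear functional whose values on monomials are given by `staircase`. -/
def stairFunctional (r : L → ℕ) (t : List (L × ℕ)) : MvPolynomial (NonBot L) ℚ →ₗ[ℚ] ℚ :=
  (MvPolynomial.basisMonomials (NonBot L) ℚ).constr ℚ fun m => staircase r ⊥ t (countBelow m)

lemma stairFunctional_monomial (r : L → ℕ) (t : List (L × ℕ)) (m : NonBot L →₀ ℕ) :
    stairFunctional r t (MvPolynomial.monomial m 1) = staircase r ⊥ t (countBelow m) := by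
  have := (MvPolynomial.basisMonomials (NonBot L) ℚ).constr_basis ℚ
    (fun m => staircase r ⊥ t (countBelow m)) m
  rwa [MvPolynomial.coe_basisMonomials] at this

/-- The largest ideal contained in the kernel of a linear functional. -/
def kernelIdeal {A : Type*} [CommRing A] [Algebra ℚ A] (φ : A →ₗ[ℚ] ℚ) : Ideal A where
  carrier := {p | ∀ q, φ (q * p) = 0}
  add_mem' ha hb q := by rw [mul_add, map_add, ha, hb, add_zero]
  zero_mem' q := by rw [mul_zero, map_zero]
  smul_mem' c p hp q := by rw [smul_eq_mul, ← mul_assoc]; exact hp _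

lemma apply_eq_zero_of_mem_kernelIdeal {A : Type*} [CommRing A] [Algebra ℚ A] {φ : A →ₗ[ℚ] ℚ}
    {p : A} (hp : p ∈ kernelIdeal φ) : φ p = 0 := by
  simpa using hp 1

lemma mem_kernelIdeal_of_monomial {σ : Type*} {φ : MvPolynomial σ ℚ →ₗ[ℚ] ℚ}
    {p : MvPolynomial σ ℚ} (h : ∀ m, φ (MvPolynomial.monomial m 1 * p) = 0) : p ∈ kernelIdeal φ := by
  intro q
  induction q using MvPolynomial.induction_on' with
  | monomial m a =>
    have : MvPolynomial.monomial m a = a • MvPolynomial.monomial m (1 : ℚ) := by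
      rw [MvPolynomial.smul_monomial, smul_eq_mul, mul_one]
    rw [this, smul_mul_assoc, map_smul, h, smul_zero]
  | add p q hp hq => rw [add_mul, map_add, hp, hq, add_zero]

lemma quadric_mem_kernelIdeal {r : L → ℕ} {atom : ι → L} (hr : IsGeometricRank r atom)
    {t : List (L × ℕ)} (ht : IsNested r ⊥ t) (F G : NonBot L) :
    (MvPolynomial.X F - MvPolynomial.X (nonBotSup F G)) * (MvPolynomial.X G - MvPolynomial.X (nonBotSup F G)) ∈ kernelIdeal (stairFunctional r t) := by
  refine mem_kernelIdeal_of_monomial fun m => ?_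
  have key : ∀ A B : NonBot L, stairFunctional r t (MvPolynomial.monomial m 1 * (MvPolynomial.X A * MvPolynomial.X B)) =
      staircase r ⊥ t (countBelow m + filterInd A.1 + filterInd B.1) := fun A B => by
    rw [MvPolynomial.X, MvPolynomial.X, MvPolynomial.monomial_mul, MvPolynomial.monomial_mul, one_mul, one_mul, stairFunctional_monomial,
      countBelow_add, countBelow_add, countBelow_single_one, countBelow_single_one, add_assoc]
  have h := staircase_quadric hr (countBelow_mono m) (countBelow_supermodular m) F.1 G.1 ht
  set K := nonBotSup F G
  have : MvPolynomial.monomial m (1 : ℚ) * ((MvPolynomial.X F - MvPolynomial.X K) * (MvPolynomial.X G - MvPolynomial.X K)) =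
      MvPolynomial.monomial m 1 * (MvPolynomial.X F * MvPolynomial.X G) + MvPolynomial.monomial m 1 * (MvPolynomial.X K * MvPolynomial.X K) -
        (MvPolynomial.monomial m 1 * (MvPolynomial.X F * MvPolynomial.X K) + MvPolynomial.monomial m 1 * (MvPolynomial.X G * MvPolynomial.X K)) := by ring
  rw [this, map_sub, map_add, map_add, key, key, key, key, sub_eq_zero]
  exact h

lemma atom_mem_kernelIdeal {r : L → ℕ} {atom : ι → L} (hr : IsGeometricRank r atom)
    {t : List (L × ℕ)} (ht : IsNested r ⊥ t) (i : ι) (hi : atom i ≠ ⊥) :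
    MvPolynomial.X ⟨atom i, hi⟩ ∈ kernelIdeal (stairFunctional r t) := by
  refine mem_kernelIdeal_of_monomial fun m => ?_
  rw [MvPolynomial.X, MvPolynomial.monomial_mul, one_mul, stairFunctional_monomial, countBelow_add, countBelow_single_one]
  exact staircase_atom hr (countBelow_mono m) i ht fun h => hi (le_bot_iff.1 h)

lemma IsGeometricRank.atom_ne_bot {r : L → ℕ} {atom : ι → L} (hr : IsGeometricRank r atom)
    (i : ι) : atom i ≠ ⊥ := fun h => by
  have := hr.rank_atom i
  rw [h, hr.bot] at this; omega

/-- The defining ideal of the Chow ring of a geometric lattice, with variables indexed by any type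
in bijection with the elements other than the bottom one. -/
def latticeChowIdeal {σ : Type*} (atom : ι → L) (e : σ ≃ NonBot L) [Fintype σ] :
    Ideal (MvPolynomial σ ℚ) :=
  Ideal.span
    ({q | ∃ F G : σ, ¬ e F ≤ e G ∧ ¬ e G ≤ e F ∧ q = MvPolynomial.X F * MvPolynomial.X G} ∪
     {q | ∃ i, q = open Classical in ∑ F with atom i ≤ (e F).1, MvPolynomial.X F})

variable {σ : Type*} [Fintype σ] [Fintype (NonBot L)]

open Classical in
lemma sum_filter_atom_le {R : Type*} [CommRing R] {atom : ι → L} (e : σ ≃ NonBot L) (i : ι)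
    (hi : atom i ≠ ⊥) (x : NonBot L → R) :
    ∑ F with atom i ≤ (e F).1, x (e F) = upSum x ⟨atom i, hi⟩ := by
  rw [upSum, Finset.sum_filter, Finset.sum_filter]
  exact e.sum_comp fun G => if atom i ≤ G.1 then x G else 0

/-- The elements `y F` with `∑ G ≥ F, y G = MvPolynomial.X F`. -/
def moebiusVar : NonBot L → MvPolynomial (NonBot L) ℚ := (exists_upSum_eq MvPolynomial.X).choose

lemma upSum_moebiusVar : upSum (moebiusVar (L := L)) = MvPolynomial.X := (exists_upSum_eq MvPolynomial.X).choose_spec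

/-- Substituting `moebiusVar` for the variables turns the simplicial generators into the variables,
in which the functional is defined. -/
lemma latticeChowIdeal_le_comap {r : L → ℕ} {atom : ι → L} (hr : IsGeometricRank r atom)
    (e : σ ≃ NonBot L) {t : List (L × ℕ)} (ht : IsNested r ⊥ t) :
    latticeChowIdeal atom e ≤
      (kernelIdeal (stairFunctional r t)).comap (MvPolynomial.aeval fun F => moebiusVar (e F)) := by
  classical
  rw [latticeChowIdeal, Ideal.span_le]
  rintro q (⟨F, G, hFG, hGF, rfl⟩ | ⟨i, rfl⟩)
  · simp only [SetLike.mem_coe, Ideal.mem_comap, map_mul, MvPolynomial.aeval_X]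
    refine mul_mem_of_upSum_mul_mem nonBotSup nonBotSup_le (fun F G => ?_) hFG hGF
    rw [upSum_moebiusVar]
    exact quadric_mem_kernelIdeal hr ht F G
  · simp only [SetLike.mem_coe, Ideal.mem_comap, map_sum, MvPolynomial.aeval_X]
    rw [sum_filter_atom_le e i (hr.atom_ne_bot i), upSum_moebiusVar]
    exact atom_mem_kernelIdeal hr ht i _

/-- A monomial in the simplicial generators `upSum x F` of the Chow ring of a geometric lattice. -/
def simplicialMonomial {R : Type*} [CommRing R] (x : NonBot L → R) (m : NonBot L →₀ ℕ) : R :=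
  m.prod fun F k => upSum x F ^ k

lemma map_simplicialMonomial {R S : Type*} [CommRing R] [CommRing S] (f : R →+* S)
    (x : NonBot L → R) (m : NonBot L →₀ ℕ) :
    f (simplicialMonomial x m) = simplicialMonomial (fun F => f (x F)) m := by
  simp [simplicialMonomial, Finsupp.prod, map_prod, upSum]

lemma simplicialMonomial_moebiusVar (m : NonBot L →₀ ℕ) :
    simplicialMonomial moebiusVar m = MvPolynomial.monomial m 1 := by
  rw [simplicialMonomial, upSum_moebiusVar, MvPolynomial.monomial_eq, MvPolynomial.C_1, one_mul]

lemma linearIndependent_simplicialMonomial {r : L → ℕ} {atom : ι → L}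
    (hr : IsGeometricRank r atom) (e : σ ≃ NonBot L) :
    LinearIndependent ℚ fun t : {t // IsNested r ⊥ t} =>
      Ideal.Quotient.mk (latticeChowIdeal atom e)
        (simplicialMonomial (fun F => MvPolynomial.X (e.symm F)) (listMonomial t.1)) := by
  let φ (t : {t // IsNested r ⊥ t}) :
      (MvPolynomial σ ℚ ⧸ latticeChowIdeal atom e) →ₗ[ℚ] ℚ :=
    ((latticeChowIdeal atom e).restrictScalars ℚ).liftQ
      ((stairFunctional r t.1).comp (MvPolynomial.aeval fun F => moebiusVar (e F)).toLinearMap) fun p hp =>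
        apply_eq_zero_of_mem_kernelIdeal (φ := stairFunctional r t.1)
          (latticeChowIdeal_le_comap hr e t.2 hp)
  have hφ (t : {t // IsNested r ⊥ t}) (m : NonBot L →₀ ℕ) :
      φ t (Ideal.Quotient.mk (latticeChowIdeal atom e)
        (simplicialMonomial (fun F => MvPolynomial.X (e.symm F)) m)) =
        staircase r ⊥ t.1 (countBelow m) := by
    have h : MvPolynomial.aeval (fun F => moebiusVar (e F))
        (simplicialMonomial (fun F => MvPolynomial.X (R := ℚ) (e.symm F)) m) =
        MvPolynomial.monomial m 1 := by
      rw [← simplicialMonomial_moebiusVar]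
      refine (map_simplicialMonomial
        (MvPolynomial.aeval (R := ℚ) fun F => moebiusVar (e F)).toRingHom _ m).trans ?_
      simp
    rw [← stairFunctional_monomial, ← h]
    rfl
  refine linearIndependent_of_triangular φ (fun t => weight r (listMonomial t.1))
    (fun t => ?_) fun t t' h hne => ?_
  · rw [hφ, staircase_listMonomial hr.strictMono t.2]
  · rw [hφ] at h
    obtain ⟨h1, h2⟩ := weight_le_of_staircase_ne_zero hr.strictMono t.2 _
      (fun F _ hF => F.2 (le_bot_iff.1 hF)) h
    refine lt_of_le_of_ne h1 fun h3 => hne (Subtype.ext ?_)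
    exact (listMonomial_injective t'.2 t.2 (h2 h3)).symm

end Functional

/-! ### Straightening of monomials in the simplicial generators. -/

section Spanning

variable {L ι : Type*} [Lattice L] [BoundedOrder L]

lemma IsGeometricRank.exists_coatom [Finite L] {r : L → ℕ} {atom : ι → L}
    (hr : IsGeometricRank r atom) {A B : L} (hAB : A < B) :
    ∃ C i, A ≤ C ∧ C < B ∧ ¬ atom i ≤ C ∧ C ⊔ atom i = B ∧ r B = r C + 1 := by
  obtain ⟨C, hC, hmax⟩ := (wellFounded_gt (α := L)).has_min (Set.Ico A B) ⟨A, le_rfl, hAB⟩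
  obtain ⟨i, hiB, hiC⟩ := hr.exists_atom C B hC.2.not_ge
  have hlt : C < C ⊔ atom i := left_lt_sup.2 hiC
  have hB : C ⊔ atom i = B := by
    by_contra hne
    exact hmax _ ⟨hC.1.trans le_sup_left, (sup_le hC.2.le hiB).lt_of_ne hne⟩ hlt
  refine ⟨C, i, hC.1, hC.2, hiC, hB, ?_⟩
  have h1 := hr.strictMono hC.2
  have h2 := hr.submodular C (atom i)
  rw [hB, hr.rank_atom] at h2
  omega

lemma mul_pow_eq_of_sq_eq {R : Type*} [CommRing R] {a b : R} (h : a * a = a * b) (j : ℕ) :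
    a ^ (j + 1) = a * b ^ j := by
  induction j with
  | zero => simp
  | succ j ih => rw [pow_succ, ih, mul_right_comm, h, mul_assoc, ← pow_succ']

/-- A chain of flats with multiplicities either is one of the nested lists or violates one of the
conditions on the exponents. -/
lemma exists_listMonomial_eq_or (r : L → ℕ) (n : ℕ) :
    ∀ (A : L) (m : NonBot L →₀ ℕ), m.support.card = n → (∀ F ∈ m.support, A < F.1) →
      (∃ t, IsNested r A t ∧ listMonomial t = m) ∨
      (∃ F ∈ m.support, ∃ G ∈ m.support, ¬ F ≤ G ∧ ¬ G ≤ F) ∨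
      (∃ F ∈ m.support, r F.1 ≤ m F + r A) ∨
      (∃ F ∈ m.support, ∃ G ∈ m.support, F < G ∧ r G.1 ≤ m G + r F.1) := by
  classical
  induction n with
  | zero =>
    intro A m hm _
    refine Or.inl ⟨[], trivial, ?_⟩
    rw [Finset.card_eq_zero, Finsupp.support_eq_empty] at hm
    rw [hm, listMonomial]
  | succ n ih =>
    intro A m hm hA
    obtain ⟨F, hF⟩ := m.support.exists_minimal (Finset.card_pos.1 (by omega))
    by_cases hinc : ∃ F ∈ m.support, ∃ G ∈ m.support, ¬ F ≤ G ∧ ¬ G ≤ F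
    · exact Or.inr (Or.inl hinc)
    push Not at hinc
    have hmem : ∀ G, G ∈ (m.erase F).support ↔ G ≠ F ∧ G ∈ m.support := by simp
    have hlt : ∀ G ∈ (m.erase F).support, F.1 < G.1 := fun G hG => by
      obtain ⟨h1, h2⟩ := (hmem G).1 hG
      have h3 : F ≤ G := by
        by_contra h
        exact h (hF.2 h2 (hinc F hF.1 G h2 h))
      exact lt_of_le_of_ne h3 fun h => h1 (Subtype.ext h.symm)
    by_cases hbig : r F.1 ≤ m F + r A
    · exact Or.inr (Or.inr (Or.inl ⟨F, hF.1, hbig⟩))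
    have hne : ∀ G ∈ (m.erase F).support, m.erase F G = m G := fun G hG =>
      Finsupp.erase_ne ((hmem G).1 hG).1
    rcases ih F.1 (m.erase F) (by rw [Finsupp.support_erase, Finset.card_erase_of_mem hF.1, hm]; rfl)
      hlt with ⟨t, ht, hmt⟩ | ⟨G, hG, H, hH, h⟩ | ⟨G, hG, h⟩ | ⟨G, hG, H, hH, h1, h2⟩
    · refine Or.inl ⟨(F.1, m F) :: t, ⟨hA F hF.1, ?_, by omega, ht⟩, ?_⟩
      · exact Nat.pos_of_ne_zero (Finsupp.mem_support_iff.1 hF.1)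
      · rw [listMonomial_cons F.2, hmt, add_comm]
        exact Finsupp.erase_add_single F m
    · exact absurd (hinc G ((hmem G).1 hG).2 H ((hmem H).1 hH).2 h.1) h.2
    · exact Or.inr (Or.inr (Or.inr ⟨F, hF.1, G, ((hmem G).1 hG).2, hlt G hG, hne G hG ▸ h⟩))
    · exact Or.inr (Or.inr (Or.inr
        ⟨G, ((hmem G).1 hG).2, H, ((hmem H).1 hH).2, h1, hne H hH ▸ h2⟩))

lemma weight_le {r : L → ℕ} (hr : Monotone r) (m : NonBot L →₀ ℕ) :
    weight r m ≤ m.degree * r ⊤ := by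
  rw [Finsupp.degree_apply, Finset.sum_mul]
  exact Finset.sum_le_sum fun F _ => Nat.mul_le_mul_left _ (hr le_top)

variable [Fintype (NonBot L)] {R : Type*} [CommRing R] {x : NonBot L → R}

/-- Let `B` cover C ≥ `A` and be the join of C with an atom. As h vanishes on the atom, the quadric
reads h_B² = h_B h_C, so h_B^{j+1} = h_B h_C^j, and the claim for C gives the one for `B`. -/
lemma upSum_sub_mul_pow [Finite L] {r : L → ℕ} {atom : ι → L} (hr : IsGeometricRank r atom)
    (hx : ∀ F G, ¬ F ≤ G → ¬ G ≤ F → x F * x G = 0)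
    (hatom : ∀ i, upSum x ⟨atom i, hr.atom_ne_bot i⟩ = 0) {A B : NonBot L} (hAB : A ≤ B) :
    (upSum x B - upSum x A) * upSum x B ^ (r B.1 - r A.1) = 0 := by
  obtain ⟨B, hB⟩ := B
  induction B using (wellFounded_lt (α := L)).induction with
  | _ B ih =>
    rcases hAB.eq_or_lt with rfl | hlt
    · simp
    obtain ⟨C, i, hAC, hCB, hiC, hsup, hrank⟩ := hr.exists_coatom (A := A.1) (B := B) hlt
    have hC : C ≠ ⊥ := fun h => A.2 (le_bot_iff.1 (h ▸ hAC))
    have hsq := upSum_mul_eq_zero hx (F := ⟨C, hC⟩) (G := ⟨atom i, hr.atom_ne_bot i⟩)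
      (K := ⟨B, hB⟩) fun D =>
        (show B ≤ D.1 ↔ C ≤ D.1 ∧ atom i ≤ D.1 by rw [← hsup]; exact sup_le_iff)
    rw [hatom] at hsq
    have hsq : upSum x ⟨B, hB⟩ * upSum x ⟨B, hB⟩ = upSum x ⟨B, hB⟩ * upSum x ⟨C, hC⟩ := by
      linear_combination hsq
    have h := ih C hCB hC hAC
    have hle : r A.1 ≤ r C := hr.strictMono.monotone hAC
    dsimp only at h ⊢
    rw [hrank, show r C + 1 - r A.1 = (r C - r A.1) + 1 by omega, sub_mul, ← pow_succ',
      mul_pow_eq_of_sq_eq hsq, mul_pow_eq_of_sq_eq hsq, pow_succ]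
    linear_combination upSum x ⟨B, hB⟩ * h

lemma upSum_pow_rank [Finite L] {r : L → ℕ} {atom : ι → L} (hr : IsGeometricRank r atom)
    (hx : ∀ F G, ¬ F ≤ G → ¬ G ≤ F → x F * x G = 0)
    (hatom : ∀ i, upSum x ⟨atom i, hr.atom_ne_bot i⟩ = 0) (B : NonBot L) :
    upSum x B ^ r B.1 = 0 := by
  obtain ⟨B, hB⟩ := B
  have hpos := hr.strictMono (bot_lt_iff_ne_bot.2 hB)
  obtain ⟨i, hi, -⟩ := hr.exists_atom ⊥ B fun h => hB (le_bot_iff.1 h)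
  have h := upSum_sub_mul_pow hr hx hatom (A := ⟨atom i, hr.atom_ne_bot i⟩) (B := ⟨B, hB⟩) hi
  rwa [hatom, sub_zero, ← pow_succ', hr.rank_atom, Nat.sub_add_cancel (by dsimp only; omega)] at h

lemma simplicialMonomial_add (m m' : NonBot L →₀ ℕ) :
    simplicialMonomial x (m + m') = simplicialMonomial x m * simplicialMonomial x m' :=
  Finsupp.prod_add_index' (by simp) (by intros; rw [pow_add])

lemma simplicialMonomial_single (F : NonBot L) (k : ℕ) :
    simplicialMonomial x (Finsupp.single F k) = upSum x F ^ k :=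
  Finsupp.prod_single_index (by simp)

/-- The span of the monomials of degree `d` of Feichtner and Yuzvinsky in the simplicial
generators. -/
def nestedSpan [Algebra ℚ R] (r : L → ℕ) (x : NonBot L → R) (d : ℕ) : Submodule ℚ R :=
  Submodule.span ℚ
    ((fun t => simplicialMonomial x (listMonomial t)) '' {t | IsNested r ⊥ t ∧ listDegree t = d})

/-- `N` bounds the distance from the weight to its maximum `d * r ⊤` in degree `d`; each rewriting
raises the weight, so the induction on `N` terminates. -/
lemma simplicialMonomial_mem_nestedSpan [Algebra ℚ R] [Finite L] {r : L → ℕ} {atom : ι → L}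
    (hr : IsGeometricRank r atom) (hx : ∀ F G, ¬ F ≤ G → ¬ G ≤ F → x F * x G = 0)
    (hatom : ∀ i, upSum x ⟨atom i, hr.atom_ne_bot i⟩ = 0) (d N : ℕ) :
    ∀ m : NonBot L →₀ ℕ, m.degree = d → d * r ⊤ ≤ weight r m + N →
      simplicialMonomial x m ∈ nestedSpan r x d := by
  classical
  induction N using Nat.strong_induction_on with
  | _ N ih =>
  intro m hm hN
  have step : ∀ m' : NonBot L →₀ ℕ, m'.degree = d → weight r m < weight r m' →
      simplicialMonomial x m' ∈ nestedSpan r x d := fun m' hm' hlt => by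
    have h1 := weight_le hr.strictMono.monotone m'
    rw [hm'] at h1
    exact ih (d * r ⊤ - weight r m') (by omega) m' hm' (by omega)
  rcases exists_listMonomial_eq_or r _ ⊥ m rfl fun F _ => bot_lt_iff_ne_bot.2 F.2 with
    ⟨t, ht, rfl⟩ | ⟨F, hF, G, hG, hFG, hGF⟩ | ⟨F, hF, hle⟩ | ⟨A, hA, F, hF, hlt, hle⟩
  · exact Submodule.subset_span ⟨t, ⟨ht, by rw [← degree_listMonomial ht, hm]⟩, rfl⟩
  · have hne : F ≠ G := fun h => hFG h.le
    rw [Finsupp.mem_support_iff] at hF hG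
    have hsub : Finsupp.single F 1 + Finsupp.single G 1 ≤ m := fun H => by
      by_cases h1 : F = H <;> by_cases h2 : G = H <;>
        simp [h1, h2] <;> subst_vars <;> first | omega | exact absurd rfl hne
    obtain ⟨m', rfl⟩ := exists_add_of_le hsub
    set K := nonBotSup F G
    have hFK : r F.1 < r K.1 := hr.strictMono (left_lt_sup.2 hGF)
    have hGK : r G.1 < r K.1 := hr.strictMono (right_lt_sup.2 hFG)
    have hrel := upSum_mul_eq_zero hx (nonBotSup_le F G)
    have h1 := step (Finsupp.single F 1 + Finsupp.single K 1 + m') (by simpa using hm)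
      (by simp only [weight_add, weight_single]; omega)
    have h2 := step (Finsupp.single G 1 + Finsupp.single K 1 + m') (by simpa using hm)
      (by simp only [weight_add, weight_single]; omega)
    have h3 := step (Finsupp.single K 1 + Finsupp.single K 1 + m') (by simpa using hm)
      (by simp only [weight_add, weight_single]; omega)
    convert Submodule.sub_mem _ (Submodule.add_mem _ h1 h2) h3 using 1
    simp only [simplicialMonomial_add, simplicialMonomial_single, pow_one]
    linear_combination simplicialMonomial x m' * hrel
  · rw [hr.bot, add_zero] at hle
    obtain ⟨m', rfl⟩ := exists_add_of_le (Finsupp.single_le_iff.2 hle)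
    rw [simplicialMonomial_add, simplicialMonomial_single, upSum_pow_rank hr hx hatom, zero_mul]
    exact Submodule.zero_mem _
  · have hrlt : r A.1 < r F.1 := hr.strictMono hlt
    rw [Finsupp.mem_support_iff] at hA hF
    have hsub : Finsupp.single A 1 + Finsupp.single F (r F.1 - r A.1) ≤ m := fun H => by
      have hne := hlt.ne
      by_cases h1 : A = H <;> by_cases h2 : F = H <;>
        simp [h1, h2] <;> subst_vars <;> omega
    obtain ⟨m', rfl⟩ := exists_add_of_le hsub
    -- The relation trades the one factor h_A for a further factor h_F of larger rank.
    have h1 := step (Finsupp.single F (r F.1 - r A.1 + 1) + m')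
      (by simp only [map_add, Finsupp.degree_single] at hm ⊢; omega)
      (by simp only [weight_add, weight_single, add_mul, one_mul]; omega)
    have hrel := upSum_sub_mul_pow hr hx hatom hlt.le
    convert h1 using 1
    simp only [simplicialMonomial_add, simplicialMonomial_single, pow_succ]
    linear_combination -simplicialMonomial x m' * hrel

end Spanning

/-! ### Dimensions of the graded pieces as a count of nested chains. -/

section HilbertSeries

variable {L ι : Type*} [Lattice L] [BoundedOrder L]

lemma finite_isNested [Finite L] (r : L → ℕ) (A : L) : {t | IsNested r A t}.Finite := by
  induction A using (wellFounded_gt (α := L)).induction with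
  | _ A ih =>
    refine ((Set.finite_singleton []).union (Set.Finite.biUnion (t := fun X =>
      ⋃ a ∈ Set.Iio (r X), List.cons (X, a) '' {t | IsNested r X t}) (Set.toFinite (Set.Ioi A))
      fun X hX => (Set.finite_Iio (r X)).biUnion fun a _ => (ih X hX).image _)).subset ?_
    rintro (_ | ⟨⟨X, a⟩, t⟩) ht
    · simp
    · refine Or.inr ?_
      simp only [Set.mem_iUnion]
      exact ⟨X, ht.1, a, by have := ht.2.2.1; rw [Set.mem_Iio]; omega, t, ht.2.2.2, rfl⟩

/-- The finite set of the exponent data of the monomials of Feichtner and Yuzvinsky. -/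
def nestedLists [Finite L] (r : L → ℕ) (A : L) : Finset (List (L × ℕ)) :=
  (finite_isNested r A).toFinset

lemma mem_nestedLists [Finite L] {r : L → ℕ} {A : L} {t : List (L × ℕ)} :
    t ∈ nestedLists r A ↔ IsNested r A t := by simp [nestedLists]

/-- The generating polynomial of the monomials of Feichtner and Yuzvinsky by degree. -/
def nestedPolynomial [Finite L] (r : L → ℕ) (A : L) : ℤ[X] :=
  ∑ t ∈ nestedLists r A, X ^ listDegree t

open Classical in
lemma nestedPolynomial_eq [Fintype L] (r : L → ℕ) (A : L) :
    nestedPolynomial r A = 1 + ∑ F with A < F,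
      (∑ a ∈ Finset.Ioo 0 (r F - r A), X ^ a) * nestedPolynomial r F := by
  have h : nestedLists r A = insert [] (((Finset.univ.filter (A < ·)).sigma fun F =>
      Finset.Ioo 0 (r F - r A) ×ˢ nestedLists r F).image fun p => (p.1, p.2.1) :: p.2.2) := by
    ext t
    simp only [mem_nestedLists, Finset.mem_insert, Finset.mem_image, Finset.mem_sigma,
      Finset.mem_filter, Finset.mem_univ, true_and, Finset.mem_product, Finset.mem_Ioo]
    constructor
    · rcases t with _ | ⟨⟨F, a⟩, t⟩
      · simp
      · rintro ⟨h1, h2, h3, h4⟩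
        exact Or.inr ⟨⟨F, a, t⟩, ⟨h1, ⟨h2, Nat.lt_sub_of_add_lt h3⟩, h4⟩, rfl⟩
    · rintro (rfl | ⟨⟨F, a, t⟩, ⟨h1, h2, h3⟩, rfl⟩)
      · trivial
      · exact ⟨h1, h2.1, Nat.add_lt_of_lt_sub h2.2, h3⟩
  rw [nestedPolynomial, h, Finset.sum_insert (by simp), Finset.sum_image, Finset.sum_sigma]
  · congr 1
    refine Finset.sum_congr rfl fun F _ => ?_
    rw [nestedPolynomial, Finset.sum_mul_sum, Finset.sum_product]
    simp [listDegree, pow_add]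
  · rintro ⟨F, a, t⟩ _ ⟨F', a', t'⟩ _ h
    simp only [List.cons.injEq, Prod.mk.injEq] at h
    obtain ⟨⟨rfl, rfl⟩, rfl⟩ := h
    rfl

variable {σ : Type*}

section

variable [Fintype σ]

/-- The classes of the variables in the Chow ring of a geometric lattice. -/
def chowVar (atom : ι → L) (e : σ ≃ NonBot L) (F : NonBot L) :
    MvPolynomial σ ℚ ⧸ latticeChowIdeal atom e :=
  Ideal.Quotient.mk _ (MvPolynomial.X (e.symm F))

lemma chowVar_mul_eq_zero (atom : ι → L) (e : σ ≃ NonBot L) (F G : NonBot L) (hFG : ¬ F ≤ G)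
    (hGF : ¬ G ≤ F) : chowVar atom e F * chowVar atom e G = 0 := by
  rw [chowVar, chowVar, ← map_mul]
  exact Ideal.Quotient.eq_zero_iff_mem.2 (Ideal.subset_span
    (Or.inl ⟨_, _, by simpa using hFG, by simpa using hGF, rfl⟩))

end

variable [Fintype (NonBot L)]

lemma isHomogeneous_moebiusVar (F : NonBot L) : (moebiusVar F).IsHomogeneous 1 := by
  classical
  induction F using (wellFounded_gt (α := NonBot L)).induction with
  | _ F ih =>
    have h := congrFun (upSum_moebiusVar (L := L)) F
    rw [upSum_eq_add, ← eq_sub_iff_add_eq] at h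
    rw [h]
    exact (MvPolynomial.isHomogeneous_X _ _).sub
      (MvPolynomial.IsHomogeneous.sum _ _ _ fun G hG => ih G (by simpa using hG))

lemma isHomogeneous_simplicialMonomial (e : σ ≃ NonBot L) (m : NonBot L →₀ ℕ) :
    (simplicialMonomial (fun F => MvPolynomial.X (R := ℚ) (e.symm F)) m).IsHomogeneous
      m.degree := by
  classical
  rw [Finsupp.degree_apply]
  refine MvPolynomial.IsHomogeneous.prod _ _ _ fun F _ => ?_
  have : (upSum (fun F => MvPolynomial.X (R := ℚ) (e.symm F)) F).IsHomogeneous 1 :=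
    MvPolynomial.IsHomogeneous.sum _ _ _ fun G _ => MvPolynomial.isHomogeneous_X _ _
  simpa using this.pow (m F)

variable [Fintype σ]

lemma upSum_chowVar_atom {atom : ι → L} (e : σ ≃ NonBot L) (i : ι) (hi : atom i ≠ ⊥) :
    upSum (chowVar atom e) ⟨atom i, hi⟩ = 0 := by
  classical
  rw [← sum_filter_atom_le e i hi]
  simp only [chowVar, Equiv.symm_apply_apply]
  rw [← map_sum]
  exact Ideal.Quotient.eq_zero_iff_mem.2 (Ideal.subset_span (Or.inr ⟨i, rfl⟩))

lemma aeval_upSum_mem_nestedSpan [Finite L] {r : L → ℕ} {atom : ι → L}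
    (hr : IsGeometricRank r atom) (e : σ ≃ NonBot L) {k : ℕ} {q : MvPolynomial (NonBot L) ℚ}
    (hq : q.IsHomogeneous k) :
    MvPolynomial.aeval (upSum (chowVar atom e)) q ∈ nestedSpan r (chowVar atom e) k := by
  rw [q.as_sum, map_sum]
  refine Submodule.sum_mem _ fun m hm => ?_
  have hdeg : m.degree = k := by
    have := hq (MvPolynomial.mem_support_iff.1 hm)
    rwa [Finsupp.degree_eq_weight_one]
  rw [MvPolynomial.aeval_monomial, ← Algebra.smul_def]
  exact Submodule.smul_mem _ _ (simplicialMonomial_mem_nestedSpan hr (chowVar_mul_eq_zero atom e)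
    (fun i => upSum_chowVar_atom e i _) k _ m hdeg (Nat.le_add_left _ _))

/-- Passing to simplicial generators and back is the identity, since `upSum` determines its
argument. -/
lemma aeval_upSum_comp (atom : ι → L) (e : σ ≃ NonBot L) (p : MvPolynomial σ ℚ) :
    MvPolynomial.aeval (upSum (chowVar atom e)) (MvPolynomial.aeval (fun F => moebiusVar (e F)) p) =
      Ideal.Quotient.mkₐ ℚ (latticeChowIdeal atom e) p := by
  have key : (fun F => MvPolynomial.aeval (R := ℚ) (upSum (chowVar atom e)) (moebiusVar F)) =
      chowVar atom e := by
    refine eq_of_upSum_eq ?_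
    funext F
    have h := congrArg (MvPolynomial.aeval (R := ℚ) (upSum (chowVar atom e)))
      (congrFun (upSum_moebiusVar (L := L)) F)
    rw [MvPolynomial.aeval_X, upSum, map_sum] at h
    exact h
  rw [← AlgHom.comp_apply]
  congr 1
  refine MvPolynomial.algHom_ext fun F => ?_
  rw [AlgHom.comp_apply, MvPolynomial.aeval_X]
  refine (congrFun key (e F)).trans ?_
  simp [chowVar]

/-- The pieces of the Chow ring are spanned by the monomials of Feichtner and Yuzvinsky. -/
lemma map_homogeneousSubmodule_eq [Finite L] {r : L → ℕ} {atom : ι → L}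
    (hr : IsGeometricRank r atom) (e : σ ≃ NonBot L) (k : ℕ) :
    (MvPolynomial.homogeneousSubmodule σ ℚ k).map
      (Ideal.Quotient.mkₐ ℚ (latticeChowIdeal atom e)).toLinearMap =
      nestedSpan r (chowVar atom e) k := by
  apply le_antisymm
  · rintro _ ⟨p, hp, rfl⟩
    rw [AlgHom.toLinearMap_apply, ← aeval_upSum_comp]
    refine aeval_upSum_mem_nestedSpan hr e ?_
    simpa using MvPolynomial.IsHomogeneous.aeval hp _ fun F => isHomogeneous_moebiusVar (e F)
  · refine Submodule.span_le.2 ?_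
    rintro _ ⟨t, ⟨ht, rfl⟩, rfl⟩
    refine ⟨_, ?_, map_simplicialMonomial (Ideal.Quotient.mk (latticeChowIdeal atom e))
      (fun F => MvPolynomial.X (e.symm F)) (listMonomial t)⟩
    rw [← degree_listMonomial ht]
    exact isHomogeneous_simplicialMonomial e _

lemma linearIndependent_chowVar {r : L → ℕ} {atom : ι → L}
    (hr : IsGeometricRank r atom) (e : σ ≃ NonBot L) :
    LinearIndependent ℚ fun t : {t // IsNested r ⊥ t} =>
      simplicialMonomial (chowVar atom e) (listMonomial t.1) := by
  have := linearIndependent_simplicialMonomial hr e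
  simp only [map_simplicialMonomial] at this
  exact this

lemma finrank_map_homogeneousSubmodule [Finite L] {r : L → ℕ} {atom : ι → L}
    (hr : IsGeometricRank r atom) (e : σ ≃ NonBot L) (k : ℕ) :
    (Module.finrank ℚ ((MvPolynomial.homogeneousSubmodule σ ℚ k).map
      (Ideal.Quotient.mkₐ ℚ (latticeChowIdeal atom e)).toLinearMap) : ℤ) =
      (nestedPolynomial r (⊥ : L)).coeff k := by
  classical
  let s := (nestedLists r (⊥ : L)).filter (fun t => listDegree t = k)
  have hli : LinearIndependent ℚ fun t : s =>
      simplicialMonomial (chowVar atom e) (listMonomial t.1) :=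
    (linearIndependent_chowVar hr e).comp
      (fun t : s => ⟨t.1, mem_nestedLists.1 (Finset.mem_filter.1 t.2).1⟩)
      fun t t' h => Subtype.ext (Subtype.mk.inj h)
  have hspan : nestedSpan r (chowVar atom e) k = Submodule.span ℚ (Set.range fun t : s =>
      simplicialMonomial (chowVar atom e) (listMonomial t.1)) := by
    rw [nestedSpan]
    congr 1
    ext y
    simp [s, mem_nestedLists]
  rw [map_homogeneousSubmodule_eq hr e k, hspan, finrank_span_eq_card hli, nestedPolynomial,
    Polynomial.finsetSum_coeff]
  simp only [Polynomial.coeff_X_pow, Fintype.card_coe, s, Finset.card_filter, eq_comm (a := k)]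
  push_cast
  rfl

lemma span_chowVar_eq_top [Finite L] {r : L → ℕ} {atom : ι → L}
    (hr : IsGeometricRank r atom) (e : σ ≃ NonBot L) :
    Submodule.span ℚ (Set.range fun t : {t // IsNested r (⊥ : L) t} =>
      simplicialMonomial (chowVar atom e) (listMonomial t.1)) = ⊤ := by
  refine eq_top_iff.2 fun y _ => ?_
  obtain ⟨p, rfl⟩ := Ideal.Quotient.mkₐ_surjective ℚ _ y
  rw [← MvPolynomial.sum_homogeneousComponent p, map_sum]
  refine Submodule.sum_mem _ fun k _ => ?_
  have h : Ideal.Quotient.mkₐ ℚ (latticeChowIdeal atom e) (MvPolynomial.homogeneousComponent k p) ∈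
      nestedSpan r (chowVar atom e) k := by
    rw [← map_homogeneousSubmodule_eq hr e k]
    exact ⟨_, MvPolynomial.homogeneousComponent_mem k p, rfl⟩
  refine Submodule.span_mono ?_ h
  rintro _ ⟨t, ⟨ht, -⟩, rfl⟩
  exact ⟨⟨t, ht⟩, rfl⟩

lemma finite_latticeChowRing [Finite L] {r : L → ℕ} {atom : ι → L}
    (hr : IsGeometricRank r atom) (e : σ ≃ NonBot L) :
    Module.Finite ℚ (MvPolynomial σ ℚ ⧸ latticeChowIdeal atom e) := by
  have : Finite {t // IsNested r (⊥ : L) t} := (finite_isNested r ⊥).to_subtype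
  exact ⟨Submodule.fg_def.2 ⟨_, Set.finite_range _, span_chowVar_eq_top hr e⟩⟩

lemma finrank_latticeChowRing [Finite L] {r : L → ℕ} {atom : ι → L}
    (hr : IsGeometricRank r atom) (e : σ ≃ NonBot L) :
    (Module.finrank ℚ (MvPolynomial σ ℚ ⧸ latticeChowIdeal atom e) : ℤ) =
      (nestedPolynomial r (⊥ : L)).eval 1 := by
  have : Finite {t // IsNested r (⊥ : L) t} := (finite_isNested r ⊥).to_subtype
  have := Fintype.ofFinite {t // IsNested r (⊥ : L) t}
  have h := finrank_span_eq_card (linearIndependent_chowVar hr e)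
  rw [span_chowVar_eq_top hr e, finrank_top] at h
  rw [h, nestedPolynomial, Polynomial.eval_finsetSum]
  simp only [Polynomial.eval_pow, Polynomial.eval_X, one_pow, Finset.sum_const, nsmul_eq_mul,
    mul_one, Nat.cast_inj]
  exact Fintype.card_of_subtype _ fun t => mem_nestedLists

end HilbertSeries

/-! ### The partition lattice and the recursion for braid matroids. -/

section Setoids

variable {α : Type*} [Finite α]

instance : Finite (Setoid α) :=
  Finite.of_injective (fun S : Setoid α => (S : α → α → Prop)) fun _ _ h => Setoid.ext fun a b =>
    iff_of_eq (congrFun (congrFun h a) b)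

/-- The number of classes of an equivalence relation. -/
def numClasses (S : Setoid α) : ℕ := Nat.card (Quotient S)

/-- The rank of an equivalence relation in the lattice of partitions. -/
def setoidRank (S : Setoid α) : ℕ := Nat.card α - numClasses S

/-- The equivalence relation generated by one pair. -/
def pairSetoid (i j : α) : Setoid α := sInf {S | S i j}

omit [Finite α] in
lemma pairSetoid_le {i j : α} {S : Setoid α} : pairSetoid i j ≤ S ↔ S i j :=
  ⟨fun h => h fun _ hT => hT, fun h => sInf_le h⟩

/-- The functions which are constant on the classes of an equivalence relation. -/
def classFunctions (S : Setoid α) : Submodule ℚ (α → ℚ) where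
  carrier := {f | S ≤ Setoid.ker f}
  add_mem' {f g} hf hg i j h := by
    have h1 : f i = f j := hf h
    have h2 : g i = g j := hg h
    simp [Setoid.ker_def, h1, h2]
  zero_mem' _ _ _ := rfl
  smul_mem' c f hf i j h := by
    have h1 : f i = f j := hf h
    simp [Setoid.ker_def, h1]

omit [Finite α] in
lemma mem_classFunctions {S : Setoid α} {f : α → ℚ} :
    f ∈ classFunctions S ↔ S ≤ Setoid.ker f := Iff.rfl

lemma finrank_classFunctions (S : Setoid α) :
    Module.finrank ℚ (classFunctions S) = numClasses S := by
  have := Fintype.ofFinite (Quotient S)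
  have h : classFunctions S = LinearMap.range (LinearMap.funLeft ℚ ℚ (Quotient.mk S)) := by
    ext f
    rw [mem_classFunctions, LinearMap.mem_range]
    constructor
    · intro hf
      exact ⟨Quotient.lift f fun a b h => hf h, rfl⟩
    · rintro ⟨g, rfl⟩ i j h
      exact congrArg g (Quotient.sound h)
  rw [h, LinearMap.finrank_range_of_inj
    (LinearMap.funLeft_injective_of_surjective ℚ ℚ _ Quotient.mk_surjective), numClasses,
    Module.finrank_fintype_fun_eq_card, Nat.card_eq_fintype_card]

lemma numClasses_le (S : Setoid α) : numClasses S ≤ Nat.card α :=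
  Nat.card_le_card_of_surjective _ Quotient.mk_surjective

omit [Finite α] in
lemma numClasses_bot : numClasses (⊥ : Setoid α) = Nat.card α :=
  (Nat.card_congr (Equiv.ofBijective (Quotient.mk (⊥ : Setoid α))
    ⟨fun _ _ h => Quotient.exact h, Quotient.mk_surjective⟩)).symm

omit [Finite α] in
lemma classFunctions_anti {S T : Setoid α} (h : S ≤ T) : classFunctions T ≤ classFunctions S :=
  fun _ hf => h.trans hf

omit [Finite α] in
lemma le_of_classFunctions_le {S T : Setoid α} (h : classFunctions S ≤ classFunctions T) :
    T ≤ S := by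
  classical
  intro i j hij
  -- The indicator function of the class of `i`.
  have h1 : (fun k => if S i k then (1 : ℚ) else 0) ∈ classFunctions S := fun a b hab => by
    have : S i a ↔ S i b := ⟨fun h => S.trans' h hab, fun h => S.trans' h (S.symm' hab)⟩
    simp [Setoid.ker_def, this]
  have h2 : (if S i i then (1 : ℚ) else 0) = if S i j then 1 else 0 := h h1 hij
  rw [if_pos (S.refl' i)] at h2
  by_contra hS
  rw [if_neg hS] at h2
  exact one_ne_zero h2

lemma numClasses_strictAnti : StrictAnti (numClasses (α := α)) := fun S T h => by
  have := Fintype.ofFinite α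
  rw [← finrank_classFunctions, ← finrank_classFunctions]
  exact Submodule.finrank_lt_finrank_of_lt (lt_of_le_not_ge (classFunctions_anti h.le)
    fun h' => h.not_ge (le_of_classFunctions_le h'))

/-- The dimension formula for class functions: the intersection of the two spaces lies in that of `S
⊔ T`, and their sum lies in that of `S ⊓ T`. -/
lemma numClasses_add_le (S T : Setoid α) :
    numClasses S + numClasses T ≤ numClasses (S ⊔ T) + numClasses (S ⊓ T) := by
  have := Fintype.ofFinite α
  simp only [← finrank_classFunctions]
  rw [← Submodule.finrank_sup_add_finrank_inf_eq, add_comm]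
  refine add_le_add (Submodule.finrank_mono fun f hf => ?_) (Submodule.finrank_mono ?_)
  · exact sup_le (mem_classFunctions.1 hf.1) (mem_classFunctions.1 hf.2)
  · exact sup_le (classFunctions_anti inf_le_left) (classFunctions_anti inf_le_right)

/-- The class functions contain the kernel of f ↦ f i - f j, which has codimension at most one. -/
lemma le_numClasses_pairSetoid (i j : α) : Nat.card α ≤ numClasses (pairSetoid i j) + 1 := by
  have := Fintype.ofFinite α
  let φ : (α → ℚ) →ₗ[ℚ] ℚ := (LinearMap.proj i : (α → ℚ) →ₗ[ℚ] ℚ) - LinearMap.proj j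
  have h1 : LinearMap.ker φ ≤ classFunctions (pairSetoid i j) := fun f hf =>
    pairSetoid_le.2 (sub_eq_zero.1 hf)
  have h2 := φ.finrank_range_add_finrank_ker
  have h3 := Submodule.finrank_mono h1
  have h4 := Submodule.finrank_le (LinearMap.range φ)
  rw [finrank_classFunctions] at h3
  rw [Module.finrank_self] at h4
  rw [Module.finrank_fintype_fun_eq_card, ← Nat.card_eq_fintype_card] at h2
  omega

lemma isGeometricRank_setoidRank (n : ℕ) :
    IsGeometricRank (setoidRank (α := Fin n)) fun p : Pair n => pairSetoid p.1.1 p.1.2 where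
  bot := by rw [setoidRank, numClasses_bot, Nat.sub_self]
  strictMono S T h := by
    have h1 := numClasses_strictAnti h
    have h2 := numClasses_le S
    unfold setoidRank; omega
  submodular S T := by
    have h1 := numClasses_add_le S T
    have h2 := numClasses_le (S ⊓ T)
    have h3 := numClasses_le (S ⊔ T)
    have h4 := numClasses_le S
    have h5 := numClasses_le T
    unfold setoidRank; omega
  rank_atom p := by
    have h1 := le_numClasses_pairSetoid p.1.1 p.1.2
    have h2 : (⊥ : Setoid (Fin n)) < pairSetoid p.1.1 p.1.2 := by
      refine bot_lt_iff_ne_bot.2 fun h => ?_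
      have h3 : (⊥ : Setoid (Fin n)) p.1.1 p.1.2 := h ▸ pairSetoid_le.1 le_rfl
      exact p.2.ne h3
    have h3 := numClasses_strictAnti h2
    rw [numClasses_bot] at h3
    unfold setoidRank; omega
  exists_atom S T h := by
    have : ∃ i j, T i j ∧ ¬ S i j := by
      by_contra! h'
      exact h fun {i j} hij => h' i j hij
    obtain ⟨i, j, hT, hS⟩ := this
    rcases lt_trichotomy i j with hij | rfl | hij
    · exact ⟨⟨(i, j), hij⟩, pairSetoid_le.2 hT, fun h => hS (pairSetoid_le.1 h)⟩
    · exact absurd (S.refl' i) hS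
    · exact ⟨⟨(j, i), hij⟩, pairSetoid_le.2 (T.symm' hT),
        fun h => hS (S.symm' (pairSetoid_le.1 h))⟩

lemma pow_eq_sum_stirlingSecond (n x : ℕ) :
    x ^ n = ∑ j ∈ Finset.range (n + 1), n.stirlingSecond j * x.descFactorial j := by
  induction n with
  | zero => simp
  | succ n ih =>
    have key (j : ℕ) : x * x.descFactorial j = x.descFactorial (j + 1) + j * x.descFactorial j := by
      rw [Nat.descFactorial_succ, ← add_mul]
      rcases le_or_gt j x with h | h
      · rw [Nat.sub_add_cancel h]
      · rw [Nat.descFactorial_of_lt h, mul_zero, mul_zero]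
    have hshift := (Finset.sum_range_succ' (fun j => j * n.stirlingSecond j * x.descFactorial j)
      (n + 1)).symm.trans (Finset.sum_range_succ _ _)
    rw [Nat.stirlingSecond_eq_zero_of_lt (Nat.lt_succ_self n)] at hshift
    simp only [zero_mul, mul_zero, add_zero] at hshift
    rw [pow_succ', ih, Finset.mul_sum, Finset.sum_range_succ' _ (n + 1)]
    simp only [Nat.stirlingSecond_succ_zero, zero_mul, add_zero, Nat.stirlingSecond_succ_succ,
      add_mul _ _ (Nat.descFactorial _ _), Finset.sum_add_distrib]
    rw [hshift, ← Finset.sum_add_distrib]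
    refine Finset.sum_congr rfl fun j _ => ?_
    rw [mul_left_comm, key]; ring

/-- At x = k the falling factorials of order greater than k vanish, so the system is triangular. -/
lemma eq_of_sum_descFactorial_eq {u v : ℕ → ℕ} {N : ℕ}
    (h : ∀ x : ℕ, ∑ j ∈ Finset.range N, u j * x.descFactorial j =
      ∑ j ∈ Finset.range N, v j * x.descFactorial j) : ∀ j < N, u j = v j := by
  intro k
  induction k using Nat.strong_induction_on with
  | _ k ih =>
    intro hk
    have hx := h k
    have hsplit (w : ℕ → ℕ) : ∑ j ∈ Finset.range N, w j * k.descFactorial j =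
        ∑ j ∈ Finset.range k, w j * k.descFactorial j + w k * k.factorial := by
      rw [← Nat.descFactorial_self, ← Finset.sum_range_succ fun j => w j * k.descFactorial j]
      refine (Finset.sum_subset (Finset.range_mono hk) fun j _ hj => ?_).symm
      rw [Nat.descFactorial_of_lt (by simpa using hj), mul_zero]
    rw [hsplit, hsplit, Finset.sum_congr rfl fun j hj => by
      rw [ih j (Finset.mem_range.1 hj) ((Finset.mem_range.1 hj).trans hk)]] at hx
    exact Nat.eq_of_mul_eq_mul_right k.factorial_pos (add_left_cancel hx)

/-- Functions with a given kernel are the injective functions on the quotient. -/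
def kerEqEquivEmbedding {β : Type*} (S : Setoid α) :
    {f : α → β // Setoid.ker f = S} ≃ (Quotient S ↪ β) where
  toFun f := ⟨Quotient.lift f.1 fun a b h => by rw [← Setoid.ker_def, f.2]; exact h, by
    rintro ⟨a⟩ ⟨b⟩ h
    exact Quotient.sound (by rw [← f.2]; exact h)⟩
  invFun g := ⟨fun a => g (Quotient.mk S a), Setoid.ext fun a b => by
    rw [Setoid.ker_def, g.injective.eq_iff]; exact Quotient.eq⟩
  left_inv _ := rfl
  right_inv g := by ext ⟨a⟩; rfl

-- Maps from the classes of `A` to an x-element set are sorted by their kernel F ≥ `A`; those with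
-- kernel F are the injections from the classes of F.
open Classical in
lemma sum_descFactorial_numClasses [Fintype (Setoid α)] (A : Setoid α) (x : ℕ) :
    ∑ F with A ≤ F, x.descFactorial (numClasses F) = x ^ numClasses A := by
  have h1 : Nat.card (Quotient A → Fin x) = x ^ numClasses A := by
    rw [Nat.card_fun, Nat.card_fin]; rfl
  have e1 : (Σ F : {F : Setoid α // A ≤ F}, {f : α → Fin x // Setoid.ker f = F.1}) ≃
      {f : α → Fin x // A ≤ Setoid.ker f} :=
    { toFun := fun p => ⟨p.2.1, by rw [p.2.2]; exact p.1.2⟩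
      invFun := fun f => ⟨⟨Setoid.ker f.1, f.2⟩, f.1, rfl⟩
      left_inv := by
        rintro ⟨⟨F, hF⟩, f, hf⟩
        dsimp only at hf
        subst hf
        rfl
      right_inv := fun _ => rfl }
  have e2 : (Σ F : {F : Setoid α // A ≤ F}, (Quotient F.1 ↪ Fin x)) ≃
      {f : α → Fin x // A ≤ Setoid.ker f} :=
    (Equiv.sigmaCongrRight fun F : {F : Setoid α // A ≤ F} =>
      (kerEqEquivEmbedding F.1).symm).trans e1
  rw [← h1, ← Nat.card_congr (Setoid.liftEquiv A), ← Nat.card_congr e2, Nat.card_sigma,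
    Finset.sum_subtype (p := fun F => A ≤ F) _ (by simp)]
  refine Finset.sum_congr rfl fun F _ => ?_
  have := Fintype.ofFinite (Quotient F.1)
  rw [Nat.card_eq_fintype_card, Fintype.card_embedding_eq, Fintype.card_fin, numClasses,
    Nat.card_eq_fintype_card]

open Classical in
lemma card_numClasses_eq [Fintype (Setoid α)] (A : Setoid α) {j : ℕ} (hj : j ≤ numClasses A) :
    (Finset.univ.filter fun F => A ≤ F ∧ numClasses F = j).card =
      (numClasses A).stirlingSecond j := by
  refine eq_of_sum_descFactorial_eq (N := numClasses A + 1)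
    (u := fun j => (Finset.univ.filter fun F => A ≤ F ∧ numClasses F = j).card)
    (fun x => ?_) j (Nat.lt_succ_of_le hj)
  rw [← pow_eq_sum_stirlingSecond, ← sum_descFactorial_numClasses,
    ← Finset.sum_fiberwise_of_maps_to (t := Finset.range (numClasses A + 1)) (g := numClasses)
      fun F hF => Finset.mem_range_succ_iff.2
        (numClasses_strictAnti.antitone (Finset.mem_filter.1 hF).2)]
  refine Finset.sum_congr rfl fun j _ => ?_
  rw [Finset.filter_filter, Finset.sum_congr rfl fun F hF => by
    rw [(Finset.mem_filter.1 hF).2.2], Finset.sum_const, smul_eq_mul]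

open Classical in
lemma sum_lt_numClasses [Fintype (Setoid α)] {M : Type*} [CommRing M] (A : Setoid α)
    (g : ℕ → M) : ∑ F with A < F, g (numClasses F) =
      ∑ j ∈ Finset.range (numClasses A), (numClasses A).stirlingSecond j * g j := by
  rw [← Finset.sum_fiberwise_of_maps_to (t := Finset.range (numClasses A)) (g := numClasses)
      fun F hF => Finset.mem_range.2 (numClasses_strictAnti (Finset.mem_filter.1 hF).2)]
  refine Finset.sum_congr rfl fun j hj => ?_
  rw [Finset.mem_range] at hj
  rw [← card_numClasses_eq A hj.le, Finset.filter_filter, Finset.sum_congr rfl fun F hF => by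
    rw [(Finset.mem_filter.1 hF).2.2], Finset.sum_const, nsmul_eq_mul]
  congr 3
  ext F
  simp only [Finset.mem_filter, Finset.mem_univ, true_and]
  refine and_congr_left fun h => ⟨le_of_lt, fun h' => h'.lt_of_ne fun h'' => ?_⟩
  rw [← h, h''] at hj
  exact hj.false

/-- The Hilbert series of the Chow rings of the braid matroids, by their recursion. -/
def braidPolynomial (n : ℕ) : ℤ[X] :=
  1 + ∑ j : Fin n, (n.stirlingSecond j : ℤ[X]) *
    ((∑ a ∈ Finset.Ioo 0 (n - j), X ^ a) * braidPolynomial j)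

lemma braidPolynomial_eq (n : ℕ) : braidPolynomial n =
    1 + ∑ j ∈ Finset.range n, (n.stirlingSecond j : ℤ[X]) *
      ((∑ a ∈ Finset.Ioo 0 (n - j), X ^ a) * braidPolynomial j) := by
  rw [braidPolynomial]
  exact congrArg _ (Fin.sum_univ_eq_sum_range (fun j => (n.stirlingSecond j : ℤ[X]) *
    ((∑ a ∈ Finset.Ioo 0 (n - j), X ^ a) * braidPolynomial j)) n)

lemma nestedPolynomial_setoidRank (A : Setoid α) :
    nestedPolynomial setoidRank A = braidPolynomial (numClasses A) := by
  classical
  have := Fintype.ofFinite (Setoid α)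
  induction A using (wellFounded_gt (α := Setoid α)).induction with
  | _ A ih =>
    rw [nestedPolynomial_eq, braidPolynomial_eq, ← sum_lt_numClasses A fun j =>
      (∑ a ∈ Finset.Ioo 0 (numClasses A - j), X ^ a) * braidPolynomial j]
    congr 1
    refine Finset.sum_congr rfl fun F hF => ?_
    have hF := (Finset.mem_filter.1 hF).2
    have h1 := numClasses_strictAnti hF
    have h2 := numClasses_le A
    rw [ih F hF, show setoidRank F - setoidRank A = numClasses A - numClasses F by
      unfold setoidRank; omega]

end Setoids

/-! ### Orthogonality and first moments of Stirling numbers. -/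

section Stirling

lemma signedStirlingFirst_succ_succ (n k : ℕ) : signedStirlingFirst (n + 1) (k + 1) =
    signedStirlingFirst n k - n * signedStirlingFirst n (k + 1) := by
  simp only [signedStirlingFirst, Nat.stirlingFirst_succ_succ]
  push_cast
  ring

lemma signedStirlingFirst_succ_zero (n : ℕ) : signedStirlingFirst (n + 1) 0 = 0 := by
  simp [signedStirlingFirst]

lemma signedStirlingFirst_of_lt {n k : ℕ} (h : n < k) : signedStirlingFirst n k = 0 := by
  simp [signedStirlingFirst, Nat.stirlingFirst_eq_zero_of_lt h]

/-- With `g j` in place of x^j, this is the factorization of the falling factorial of order n + 1 as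
x - n times the one of order n. -/
lemma sum_signedStirlingFirst_succ {M : Type*} [CommRing M] (n : ℕ) (g : ℕ → M) :
    ∑ j ∈ Finset.range (n + 2), (signedStirlingFirst (n + 1) j : M) * g j =
      ∑ j ∈ Finset.range (n + 1), (signedStirlingFirst n j : M) * (g (j + 1) - n * g j) := by
  have hshift := (Finset.sum_range_succ' (fun j => (signedStirlingFirst n j : M) * g j)
    (n + 1)).symm.trans (Finset.sum_range_succ _ _)
  rw [signedStirlingFirst_of_lt (Nat.lt_succ_self n), Int.cast_zero, zero_mul, add_zero] at hshift
  rw [Finset.sum_range_succ', signedStirlingFirst_succ_zero, Int.cast_zero, zero_mul, add_zero]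
  simp only [mul_sub, Finset.sum_sub_distrib]
  simp only [mul_left_comm _ (n : M), ← Finset.mul_sum]
  rw [← hshift]
  simp only [signedStirlingFirst_succ_succ, Int.cast_sub, Int.cast_mul, Int.cast_natCast, sub_mul,
    Finset.sum_sub_distrib, mul_assoc, ← Finset.mul_sum]
  have h0 : (n : M) * (signedStirlingFirst n 0 * g 0) = 0 := by
    cases n with
    | zero => simp
    | succ n => simp [signedStirlingFirst_succ_zero]
  rw [mul_add, h0, add_zero]

/-- The orthogonality relation of the Stirling numbers. -/
lemma sum_signedStirlingFirst_mul_stirlingSecond (n k : ℕ) :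
    ∑ j ∈ Finset.range (n + 1), signedStirlingFirst n j * (j.stirlingSecond k : ℤ) =
      if n = k then 1 else 0 := by
  induction n generalizing k with
  | zero => cases k <;> simp [signedStirlingFirst]
  | succ n ih =>
    have h := sum_signedStirlingFirst_succ n fun j => (j.stirlingSecond k : ℤ)
    simp only [Int.cast_id] at h
    rw [h]
    cases k with
    | zero =>
      have h0 := ih 0
      simp only [Nat.stirlingSecond_succ_zero, Nat.cast_zero, zero_sub, mul_neg,
        Finset.sum_neg_distrib, mul_left_comm _ (n : ℤ), ← Finset.mul_sum, h0]
      by_cases hn : n = 0 <;> simp [hn]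
    | succ k =>
      have e (j : ℕ) : signedStirlingFirst n j * (((j + 1).stirlingSecond (k + 1) : ℤ) -
          n * j.stirlingSecond (k + 1)) = signedStirlingFirst n j * (j.stirlingSecond k : ℤ) +
          ((k : ℤ) + 1 - n) * (signedStirlingFirst n j * (j.stirlingSecond (k + 1) : ℤ)) := by
        rw [Nat.stirlingSecond_succ_succ]; push_cast; ring
      simp only [e, Finset.sum_add_distrib, ← Finset.mul_sum, ih, Nat.succ_inj]
      split_ifs with h1 h2 h2
      · omega
      · simp
      · rw [h2]; push_cast; ring
      · simp

/-- The sum `∑ j, j * s(n, j) * S(j, k)`. -/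
def stirlingMoment (n k : ℕ) : ℤ :=
  ∑ j ∈ Finset.range (n + 1), signedStirlingFirst n j * ((j : ℤ) * j.stirlingSecond k)

lemma stirlingMoment_zero (n : ℕ) : stirlingMoment n 0 = 0 := by
  refine Finset.sum_eq_zero fun j _ => ?_
  cases j <;> simp

lemma stirlingMoment_of_lt {n k : ℕ} (h : n < k) : stirlingMoment n k = 0 := by
  refine Finset.sum_eq_zero fun j hj => ?_
  rw [Nat.stirlingSecond_eq_zero_of_lt ((Nat.lt_succ_iff.1 (Finset.mem_range.1 hj)).trans_lt h)]
  simp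

lemma stirlingMoment_succ_succ (n k : ℕ) : stirlingMoment (n + 1) (k + 1) =
    stirlingMoment n k + ((k : ℤ) + 1 - n) * stirlingMoment n (k + 1) +
      (if n = k then 1 else 0) + ((k : ℤ) + 1) * (if n = k + 1 then 1 else 0) := by
  have h := sum_signedStirlingFirst_succ n fun j => (j : ℤ) * (j.stirlingSecond (k + 1) : ℤ)
  simp only [Int.cast_id] at h
  have e (j : ℕ) : signedStirlingFirst n j * (((j + 1 : ℕ) : ℤ) *
      ((j + 1).stirlingSecond (k + 1) : ℤ) - n * ((j : ℤ) * j.stirlingSecond (k + 1))) =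
      signedStirlingFirst n j * ((j : ℤ) * j.stirlingSecond k) +
      ((k : ℤ) + 1 - n) * (signedStirlingFirst n j * ((j : ℤ) * j.stirlingSecond (k + 1))) +
      signedStirlingFirst n j * (j.stirlingSecond k : ℤ) +
      ((k : ℤ) + 1) * (signedStirlingFirst n j * (j.stirlingSecond (k + 1) : ℤ)) := by
    rw [Nat.stirlingSecond_succ_succ]; push_cast; ring
  simp only [e, Finset.sum_add_distrib, ← Finset.mul_sum,
    sum_signedStirlingFirst_mul_stirlingSecond] at h
  exact h

lemma stirlingMoment_self (n : ℕ) : stirlingMoment n n = n := by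
  induction n with
  | zero => exact stirlingMoment_zero 0
  | succ n ih => simp [stirlingMoment_succ_succ, ih, stirlingMoment_of_lt]

/-- Off the diagonal the recursion has factor -(d + 1) and reduces to Pascal's rule; for d = 0 the
delta term of the recursion supplies the second binomial coefficient. -/
lemma stirlingMoment_eq (m d : ℕ) : stirlingMoment (m + d + 2) (m + 1) =
    ((m + d + 2).choose m : ℤ) * (d.factorial : ℤ) * (-1) ^ d := by
  induction m generalizing d with
  | zero =>
    induction d with
    | zero => simp [stirlingMoment_succ_succ, stirlingMoment_zero, stirlingMoment_of_lt]
    | succ d ih =>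
      rw [stirlingMoment_succ_succ, stirlingMoment_zero, show 0 + (d + 1) + 1 = 0 + d + 2 by ring,
        ih, if_neg (by omega), if_neg (by omega), Nat.factorial_succ]
      simp only [Nat.choose_zero_right]
      push_cast
      ring
  | succ m ihm =>
    have h1 := ihm d
    induction d with
    | zero =>
      rw [stirlingMoment_succ_succ, show m + 1 + 0 + 1 = m + 0 + 2 by ring, h1,
        show m + 0 + 2 = m + 1 + 1 by ring, stirlingMoment_self, if_neg (by omega), if_pos rfl,
        show m + 1 + 0 + 2 = m + 1 + 1 + 1 by ring, Nat.choose_succ_succ (m + 1 + 1) m,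
        Nat.choose_succ_self_right (m + 1)]
      push_cast
      simp
    | succ d ih =>
      rw [stirlingMoment_succ_succ, show m + 1 + (d + 1) + 1 = m + (d + 1) + 2 by ring, h1,
        show m + (d + 1) + 2 = m + 1 + d + 2 by ring, ih (ihm d), if_neg (by omega),
        if_neg (by omega), show m + 1 + (d + 1) + 2 = m + 1 + d + 2 + 1 by ring,
        Nat.choose_succ_succ (m + 1 + d + 2) m, Nat.factorial_succ]
      push_cast
      ring

end Stirling

/-! ### Stirling inversion of the recursion and evaluation at one. -/

section Recursion

lemma X_sub_one_mul_sum_Ioo {d : ℕ} (hd : 0 < d) :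
    (X - 1 : ℤ[X]) * ∑ a ∈ Finset.Ioo 0 d, X ^ a = X ^ d - X := by
  obtain ⟨d, rfl⟩ : ∃ e, d = e + 1 := ⟨d - 1, by omega⟩
  have h : Finset.Ioo 0 (d + 1) = Finset.Ico 1 (d + 1) := rfl
  rw [h, mul_comm, geom_sum_Ico_mul _ (by omega), pow_one]

/-- The recursion in the form of a convolution with the Stirling numbers of the second kind. -/
lemma sum_stirlingSecond_mul_braidPolynomial (n : ℕ) :
    ∑ k ∈ Finset.range (n + 1), (n.stirlingSecond k : ℤ[X]) * X ^ (n - k) * braidPolynomial k =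
      X * ∑ k ∈ Finset.range (n + 1), (n.stirlingSecond k : ℤ[X]) * braidPolynomial k + (1 - X) := by
  have hb := braidPolynomial_eq n
  rw [Finset.sum_range_succ, Finset.sum_range_succ _ n, Nat.stirlingSecond_self, Nat.sub_self,
    pow_zero, Nat.cast_one, one_mul, one_mul, mul_add, Finset.mul_sum]
  have h : (X - 1) * braidPolynomial n = (X - 1) +
      (∑ k ∈ Finset.range n, (n.stirlingSecond k : ℤ[X]) * X ^ (n - k) * braidPolynomial k -
        ∑ k ∈ Finset.range n, X * ((n.stirlingSecond k : ℤ[X]) * braidPolynomial k)) := by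
    conv_lhs => rw [hb]
    rw [mul_add, mul_one, Finset.mul_sum, ← Finset.sum_sub_distrib]
    refine congrArg _ (Finset.sum_congr rfl fun k hk => ?_)
    have e := X_sub_one_mul_sum_Ioo (Nat.sub_pos_of_lt (Finset.mem_range.1 hk))
    rw [mul_left_comm, ← mul_assoc (X - 1), e, sub_mul, mul_sub, mul_assoc, mul_left_comm X]
  rw [sub_mul, one_mul] at h
  generalize braidPolynomial n = b at h ⊢
  linear_combination -h

lemma sum_signedStirlingFirst_eq_zero {n : ℕ} (hn : 2 ≤ n) :
    ∑ j ∈ Finset.range (n + 1), signedStirlingFirst n j = 0 := by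
  have h := sum_signedStirlingFirst_mul_stirlingSecond n 1
  rw [if_neg (by omega)] at h
  rw [← h]
  refine Finset.sum_congr rfl fun j _ => ?_
  cases j with
  | zero => obtain ⟨m, rfl⟩ : ∃ m, n = m + 1 := ⟨n - 1, by omega⟩
            simp [signedStirlingFirst_succ_zero]
  | succ j => rw [Nat.stirlingSecond_one_right, Nat.cast_one, mul_one]

/-- The coefficient of `braidPolynomial k` in the inverted recursion. -/
def stirlingKernel (n k : ℕ) : ℤ[X] :=
  ∑ j ∈ Finset.Icc k n, C (signedStirlingFirst n j * (j.stirlingSecond k : ℤ)) * X ^ (j - k)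

lemma stirlingKernel_eq (n k : ℕ) : stirlingKernel n k = ∑ j ∈ Finset.range (n + 1),
    (signedStirlingFirst n j : ℤ[X]) * ((j.stirlingSecond k : ℤ[X]) * X ^ (j - k)) := by
  rw [stirlingKernel]
  refine (Finset.sum_subset (fun j hj => ?_) fun j _ hj => ?_).trans
    (Finset.sum_congr rfl fun j _ => ?_)
  · rw [Finset.mem_range_succ_iff]; exact (Finset.mem_Icc.1 hj).2
  · rw [Nat.stirlingSecond_eq_zero_of_lt]
    · simp
    · simp_all
  · rw [C_mul, ← mul_assoc]; simp

lemma sum_braidPolynomial_mul_stirlingKernel {n : ℕ} (hn : 2 ≤ n) :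
    ∑ k ∈ Finset.range (n + 1), braidPolynomial k * stirlingKernel n k = X * braidPolynomial n := by
  have extend (j : ℕ) (hj : j ∈ Finset.range (n + 1)) (g : ℕ → ℤ[X]) :
      ∑ k ∈ Finset.range (n + 1), (j.stirlingSecond k : ℤ[X]) * g k =
        ∑ k ∈ Finset.range (j + 1), (j.stirlingSecond k : ℤ[X]) * g k := by
    refine (Finset.sum_subset (Finset.range_mono (by simpa using hj)) fun k _ hk => ?_).symm
    rw [Nat.stirlingSecond_eq_zero_of_lt (by simpa using hk), Nat.cast_zero, zero_mul]
  have swap (g : ℕ → ℕ → ℤ[X]) : ∑ k ∈ Finset.range (n + 1), braidPolynomial k *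
      ∑ j ∈ Finset.range (n + 1), (signedStirlingFirst n j : ℤ[X]) *
        ((j.stirlingSecond k : ℤ[X]) * g j k) =
      ∑ j ∈ Finset.range (n + 1), (signedStirlingFirst n j : ℤ[X]) *
        ∑ k ∈ Finset.range (j + 1), (j.stirlingSecond k : ℤ[X]) * (g j k * braidPolynomial k) := by
    simp only [Finset.mul_sum]
    rw [Finset.sum_comm]
    refine Finset.sum_congr rfl fun j hj => ?_
    rw [← Finset.mul_sum, ← extend j hj, Finset.mul_sum]
    refine Finset.sum_congr rfl fun k _ => by ring
  simp only [stirlingKernel_eq]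
  rw [swap fun j k => X ^ (j - k)]
  -- Stirling inversion of the sum on the right of the convolution identity.
  have hinv : braidPolynomial n = ∑ j ∈ Finset.range (n + 1), (signedStirlingFirst n j : ℤ[X]) *
      ∑ k ∈ Finset.range (j + 1), (j.stirlingSecond k : ℤ[X]) * (1 * braidPolynomial k) := by
    rw [← swap fun _ _ => 1]
    have e (k : ℕ) : ∑ j ∈ Finset.range (n + 1), (signedStirlingFirst n j : ℤ[X]) *
        ((j.stirlingSecond k : ℤ[X]) * 1) = if n = k then 1 else 0 := by
      have := congrArg (Int.cast : ℤ → ℤ[X]) (sum_signedStirlingFirst_mul_stirlingSecond n k)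
      push_cast at this
      simpa using this
    simp only [e]
    simp
  have hterm (j : ℕ) (_ : j ∈ Finset.range (n + 1)) :
      (signedStirlingFirst n j : ℤ[X]) * ∑ k ∈ Finset.range (j + 1),
        (j.stirlingSecond k : ℤ[X]) * (X ^ (j - k) * braidPolynomial k) =
      X * ((signedStirlingFirst n j : ℤ[X]) * ∑ k ∈ Finset.range (j + 1),
        (j.stirlingSecond k : ℤ[X]) * (1 * braidPolynomial k)) +
        (signedStirlingFirst n j : ℤ[X]) * (1 - X) := by
    have := sum_stirlingSecond_mul_braidPolynomial j
    simp only [one_mul, ← mul_assoc] at this ⊢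
    rw [this]
    ring
  rw [Finset.sum_congr rfl hterm, Finset.sum_add_distrib, ← Finset.mul_sum, ← hinv,
    ← Finset.sum_mul, ← Int.cast_sum, sum_signedStirlingFirst_eq_zero hn]
  simp

lemma stirlingKernel_self (n : ℕ) : stirlingKernel n n = 1 := by
  simp [stirlingKernel, signedStirlingFirst, Nat.stirlingFirst_self, Nat.stirlingSecond_self,
    ← two_mul]

lemma stirlingKernel_zero {n : ℕ} (hn : 0 < n) : stirlingKernel n 0 = 0 := by
  rw [stirlingKernel_eq]
  refine Finset.sum_eq_zero fun j _ => ?_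
  cases j with
  | zero => obtain ⟨m, rfl⟩ : ∃ m, n = m + 1 := ⟨n - 1, by omega⟩
            simp [signedStirlingFirst_succ_zero]
  | succ j => simp

lemma X_sub_one_mul_braidPolynomial {n : ℕ} (hn : 2 ≤ n) :
    (X - 1) * braidPolynomial n =
      ∑ k ∈ Finset.Icc 1 (n - 1), braidPolynomial k * stirlingKernel n k := by
  have h := sum_braidPolynomial_mul_stirlingKernel hn
  obtain ⟨m, rfl⟩ : ∃ m, n = m + 1 := ⟨n - 1, by omega⟩
  rw [Finset.sum_range_succ, stirlingKernel_self, Finset.sum_range_succ',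
    stirlingKernel_zero (by omega), mul_zero, add_zero] at h
  rw [Nat.add_sub_cancel, ← Finset.Ico_add_one_right_eq_Icc, Finset.sum_Ico_eq_sum_range]
  simp only [Nat.add_sub_cancel, add_comm 1]
  linear_combination -h

lemma eval_one_stirlingKernel {n k : ℕ} (hk : k < n) : (stirlingKernel n k).eval 1 = 0 := by
  have h := sum_signedStirlingFirst_mul_stirlingSecond n k
  rw [if_neg hk.ne'] at h
  rw [stirlingKernel_eq, eval_finsetSum]
  simpa using h

/-- Differentiation produces the factor j - k; the part with k vanishes by orthogonality and the
part with j is `stirlingMoment`. -/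
lemma eval_one_derivative_stirlingKernel {n k : ℕ} (hk0 : k ≠ 0) (hk : k < n) :
    (derivative (stirlingKernel n k)).eval 1 =
      (n.choose (k - 1) : ℤ) * ((n - k - 1).factorial : ℤ) * (-1) ^ (n - k - 1) := by
  have h0 := sum_signedStirlingFirst_mul_stirlingSecond n k
  rw [if_neg hk.ne'] at h0
  have h : stirlingMoment n k =
      (n.choose (k - 1) : ℤ) * ((n - k - 1).factorial : ℤ) * (-1) ^ (n - k - 1) := by
    obtain ⟨m, rfl⟩ : ∃ m, k = m + 1 := ⟨k - 1, by omega⟩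
    obtain ⟨d, rfl⟩ : ∃ d, n = m + d + 2 := ⟨n - (m + 2), by omega⟩
    rw [stirlingMoment_eq, show m + d + 2 - (m + 1) - 1 = d by omega, Nat.add_sub_cancel]
  rw [← h, stirlingKernel_eq, derivative_sum, eval_finsetSum]
  have e : ∀ j ∈ Finset.range (n + 1), (derivative ((signedStirlingFirst n j : ℤ[X]) *
      ((j.stirlingSecond k : ℤ[X]) * X ^ (j - k)))).eval 1 =
      signedStirlingFirst n j * ((j : ℤ) * j.stirlingSecond k) -
        k * (signedStirlingFirst n j * (j.stirlingSecond k : ℤ)) := fun j _ => by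
    -- Where the exponent j - k is truncated, S(j, k) = 0.
    rcases lt_or_ge j k with hjk | hjk
    · simp [Nat.stirlingSecond_eq_zero_of_lt hjk]
    · simp [derivative_X_pow, Nat.cast_sub hjk]
      ring
  rw [Finset.sum_congr rfl e, Finset.sum_sub_distrib, ← Finset.mul_sum, h0, mul_zero, sub_zero, stirlingMoment]

/-- The kernels with k < n vanish at one, so the derivatives of the Chow polynomials drop out. -/
lemma eval_one_braidPolynomial {n : ℕ} (hn : 2 ≤ n) :
    (braidPolynomial n).eval 1 = ∑ k ∈ Finset.Icc 1 (n - 1), (braidPolynomial k).eval 1 *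
      (n.choose (k - 1) : ℤ) * ((n - k - 1).factorial : ℤ) * (-1) ^ (n - k - 1) := by
  have h := congrArg (fun p => (derivative p).eval 1) (X_sub_one_mul_braidPolynomial hn)
  simp only [derivative_mul, derivative_sum, eval_finsetSum, eval_add, eval_mul, derivative_sub,
    derivative_X, derivative_one, sub_zero, eval_one, one_mul, eval_sub, eval_X, sub_self,
    zero_mul, add_zero] at h
  rw [h]
  refine Finset.sum_congr rfl fun k hk => ?_
  rw [Finset.mem_Icc] at hk
  rw [eval_one_stirlingKernel (by omega), eval_one_derivative_stirlingKernel (by omega) (by omega)]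
  ring

end Recursion

/-! ### Flats of the braid matroid as partitions. -/

section Flats

lemma isFlat_vectorMatroid_iff {K W α : Type*} [Field K] [AddCommGroup W] [Module K W] [Finite α]
    (v : α → W) (F : Set α) :
    (vectorMatroid K v).IsFlat F ↔ ∀ e, v e ∈ Submodule.span K (v '' F) → e ∈ F := by
  have hE : (vectorMatroid K v).E = Set.univ := rfl
  have hindep (I : Set α) : (vectorMatroid K v).Indep I ↔ LinearIndepOn K v I := Iff.rfl
  obtain ⟨I, hI⟩ := (vectorMatroid K v).exists_isBasis F (by rw [hE]; exact Set.subset_univ _)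
  have hspan : Submodule.span K (v '' F) = Submodule.span K (v '' I) := by
    refine le_antisymm (Submodule.span_le.2 ?_) (Submodule.span_mono (Set.image_mono hI.subset))
    rintro _ ⟨e, he, rfl⟩
    by_cases heI : e ∈ I
    · exact Submodule.subset_span ⟨e, heI, rfl⟩
    · by_contra hns
      have h1 : (vectorMatroid K v).Indep (insert e I) :=
        (hindep _).2 (((hindep I).1 hI.indep).insert hns)
      exact heI (hI.mem_of_insert_indep he h1)
  rw [Matroid.isFlat_iff_closure_eq, hspan, ← hI.closure_eq_closure]
  have hmem (e : α) : e ∈ (vectorMatroid K v).closure I ↔ v e ∈ Submodule.span K (v '' I) := by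
    by_cases heI : e ∈ I
    · exact iff_of_true (hI.indep.mem_closure_iff'.2 ⟨Set.mem_univ _, fun _ => heI⟩)
        (Submodule.subset_span ⟨e, heI, rfl⟩)
    · rw [hI.indep.mem_closure_iff', hindep, linearIndepOn_insert heI, ← hindep]
      have : e ∈ (vectorMatroid K v).E := Set.mem_univ _
      have := hI.indep
      tauto
  constructor
  · intro h e he
    rw [← h]; exact (hmem e).2 he
  · intro h
    refine Set.Subset.antisymm (fun e he => h e ((hmem e).1 he)) fun e he => (hmem e).2 ?_
    rw [← hspan]
    exact Submodule.subset_span ⟨e, he, rfl⟩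

/-- The set of hyperplanes `z_i = z_j` with `i` and `j` equivalent. -/
def setoidFlat {n : ℕ} (S : Setoid (Fin n)) : Set (Pair n) := {p | S p.1.1 p.1.2}

lemma setoidFlat_subset_iff {n : ℕ} {S T : Setoid (Fin n)} :
    setoidFlat S ⊆ setoidFlat T ↔ S ≤ T := by
  refine ⟨fun h i j hij => ?_, fun h p hp => h hp⟩
  rcases lt_trichotomy i j with hlt | rfl | hlt
  · exact @h ⟨(i, j), hlt⟩ hij
  · exact T.refl' i
  · exact T.symm' (@h ⟨(j, i), hlt⟩ (S.symm' hij))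

lemma setoidFlat_nonempty_iff {n : ℕ} {S : Setoid (Fin n)} : (setoidFlat S).Nonempty ↔ S ≠ ⊥ := by
  rw [ne_eq, ← le_bot_iff, ← setoidFlat_subset_iff]
  have : setoidFlat (⊥ : Setoid (Fin n)) = ∅ := by
    refine Set.eq_empty_of_forall_notMem fun p hp => p.2.ne hp
  rw [this, Set.subset_empty_iff, Set.nonempty_iff_ne_empty]

lemma isFlat_setoidFlat {n : ℕ} (S : Setoid (Fin n)) :
    (braidMatroid n).IsFlat (setoidFlat S) := by
  classical
  refine (isFlat_vectorMatroid_iff _ _).2 fun p hp => ?_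
  -- The coordinate sum over the class of the first index of `p`: it kills the normal vectors of all
  -- pairs inside classes, and takes the value 1 at `p` if the pair is not equivalent.
  let φ : (Fin n → ℂ) →ₗ[ℂ] ℂ := ∑ k with S p.1.1 k, LinearMap.proj k
  have hφ (q : Pair n) : φ (normalVector n q) =
      (if S p.1.1 q.1.1 then 1 else 0) - if S p.1.1 q.1.2 then 1 else 0 := by
    simp [φ, normalVector, LinearMap.sum_apply, Pi.single_apply, Finset.sum_sub_distrib]
  have h : φ (normalVector n p) = 0 := by
    refine (Submodule.span_le.2 ?_ : _ ≤ LinearMap.ker φ) hp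
    rintro _ ⟨q, hq, rfl⟩
    have hq : S q.1.1 q.1.2 := hq
    have : S p.1.1 q.1.1 ↔ S p.1.1 q.1.2 :=
      ⟨fun h => S.trans' h hq, fun h => S.trans' h (S.symm' hq)⟩
    simp [hφ, this]
  rw [hφ, if_pos (S.refl' _)] at h
  by_contra hS
  have hS : ¬ S p.1.1 p.1.2 := hS
  rw [if_neg hS] at h
  simp at h

/-- The partition relates i and j when e_i - e_j lies in the span of the flat; transitivity is e_i -
e_k = (e_i - e_j) + (e_j - e_k). -/
lemma exists_setoidFlat_eq {n : ℕ} {F : Set (Pair n)} (hF : (braidMatroid n).IsFlat F) :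
    ∃ S, setoidFlat S = F := by
  let v (i j : Fin n) : Fin n → ℂ := Pi.single i 1 - Pi.single j 1
  refine ⟨⟨fun i j => v i j ∈ Submodule.span ℂ (normalVector n '' F), ⟨fun i => ?_, fun {i j} h => ?_,
    fun {i j k} h1 h2 => ?_⟩⟩, Set.Subset.antisymm (fun p hp => ?_) fun p hp => ?_⟩
  · simp [v]
  · have := Submodule.neg_mem _ h
    rwa [neg_sub] at this
  · have := Submodule.add_mem _ h1 h2
    rwa [sub_add_sub_cancel] at this
  · exact (isFlat_vectorMatroid_iff _ _).1 hF p hp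
  · exact Submodule.subset_span ⟨p, hp, rfl⟩

/-- The nonempty flats of the braid matroid are the partitions other than the discrete one. -/
def nonBotEquivNonemptyFlat (n : ℕ) : NonBot (Setoid (Fin n)) ≃ NonemptyFlat (braidMatroid n) :=
  Equiv.ofBijective
    (fun S => ⟨setoidFlat S.1, isFlat_setoidFlat S.1, setoidFlat_nonempty_iff.2 S.2⟩)
    ⟨fun S T h => by
      have h : setoidFlat S.1 = setoidFlat T.1 := congrArg Subtype.val h
      exact Subtype.ext (le_antisymm (setoidFlat_subset_iff.1 h.subset)
        (setoidFlat_subset_iff.1 h.superset)), fun F => by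
      obtain ⟨S, hS⟩ := exists_setoidFlat_eq F.2.1
      exact ⟨⟨S, setoidFlat_nonempty_iff.1 (by rw [hS]; exact F.2.2)⟩, Subtype.ext hS⟩⟩

lemma setoidFlat_symm_apply {n : ℕ} (F : NonemptyFlat (braidMatroid n)) :
    setoidFlat ((nonBotEquivNonemptyFlat n).symm F).1 = F.1 :=
  congrArg Subtype.val ((nonBotEquivNonemptyFlat n).apply_symm_apply F)

lemma chowIdeal_braidMatroid (n : ℕ) [Fintype (NonemptyFlat (braidMatroid n))] :
    chowIdeal (braidMatroid n) = latticeChowIdeal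
      (fun p : Pair n => pairSetoid p.1.1 p.1.2) (nonBotEquivNonemptyFlat n).symm := by
  classical
  have hle (F G : NonemptyFlat (braidMatroid n)) : (nonBotEquivNonemptyFlat n).symm F ≤
      (nonBotEquivNonemptyFlat n).symm G ↔ F.1 ⊆ G.1 := by
    rw [← setoidFlat_symm_apply F, ← setoidFlat_symm_apply G, setoidFlat_subset_iff]
    rfl
  have hmem (p : Pair n) (F : NonemptyFlat (braidMatroid n)) :
      pairSetoid p.1.1 p.1.2 ≤ ((nonBotEquivNonemptyFlat n).symm F).1 ↔ p ∈ F.1 := by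
    rw [pairSetoid_le, ← setoidFlat_symm_apply F]
    rfl
  rw [chowIdeal, latticeChowIdeal]
  simp only [hle, hmem]
  congr 2
  ext q
  have hE (p : Pair n) : p ∈ (braidMatroid n).E := Set.mem_univ p
  have hsum (p : Pair n) : ∑ᶠ (F : NonemptyFlat (braidMatroid n)) (_ : p ∈ F.1),
      MvPolynomial.X (R := ℚ) F = ∑ F with p ∈ F.1, MvPolynomial.X F := by
    refine (finsum_mem_eq_finite_toFinset_sum _
      (Set.toFinite {F : NonemptyFlat (braidMatroid n) | p ∈ F.1})).trans ?_
    exact Finset.sum_congr (by ext; simp) fun _ _ => rfl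
  simp only [Set.mem_ofPred_eq, hE, true_and, hsum]

end Flats

/-! ### Identification of the Chow polynomial and the total dimension. -/

section Main

lemma finrank_chowPiece (n k : ℕ) :
    (Module.finrank ℚ (chowPiece (braidMatroid n) k) : ℤ) = (braidPolynomial n).coeff k := by
  have := Fintype.ofFinite (NonemptyFlat (braidMatroid n))
  have := Fintype.ofFinite (NonBot (Setoid (Fin n)))
  have h := finrank_map_homogeneousSubmodule (isGeometricRank_setoidRank n)
    (nonBotEquivNonemptyFlat n).symm k
  rw [nestedPolynomial_setoidRank, numClasses_bot, Nat.card_fin, ← chowIdeal_braidMatroid] at h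
  exact h

lemma finite_chowRing (n : ℕ) : Module.Finite ℚ (ChowRing (braidMatroid n)) := by
  have := Fintype.ofFinite (NonemptyFlat (braidMatroid n))
  have := Fintype.ofFinite (NonBot (Setoid (Fin n)))
  have h := finite_latticeChowRing (isGeometricRank_setoidRank n)
    (nonBotEquivNonemptyFlat n).symm
  rw [← chowIdeal_braidMatroid] at h
  exact h

lemma finrank_chowRing (n : ℕ) :
    (Module.finrank ℚ (ChowRing (braidMatroid n)) : ℤ) = (braidPolynomial n).eval 1 := by
  have := Fintype.ofFinite (NonemptyFlat (braidMatroid n))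
  have := Fintype.ofFinite (NonBot (Setoid (Fin n)))
  have h := finrank_latticeChowRing (isGeometricRank_setoidRank n)
    (nonBotEquivNonemptyFlat n).symm
  rw [nestedPolynomial_setoidRank, numClasses_bot, Nat.card_fin, ← chowIdeal_braidMatroid] at h
  exact h

lemma braidPolynomial_one : braidPolynomial 1 = 1 := by
  rw [braidPolynomial]
  simp

lemma chowPolynomial_eq (n : ℕ) : chowPolynomial n = braidPolynomial n := by
  rw [chowPolynomial]
  split_ifs with h
  · rw [h, braidPolynomial_one]
  · simp only [finrank_chowPiece]
    rw [finsum_eq_sum_of_support_subset (s := (braidPolynomial n).support) _ fun k hk => by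
      simp only [Function.mem_support] at hk
      simp only [Finset.mem_coe, mem_support_iff]
      exact fun h => hk (by rw [h, C_0, zero_mul])]
    exact ((braidPolynomial n).as_sum_support_C_mul_X_pow).symm

lemma totalDim_eq (n : ℕ) : (totalDim n : ℤ) = (braidPolynomial n).eval 1 := by
  rw [totalDim]
  split_ifs with h
  · rw [h, braidPolynomial_one]; simp
  · exact finrank_chowRing n

end Main

end BraidChow

end

theorem corollaryB :
    -- The Chow rings are finite-dimensional, and the coefficients of the Chow polynomials
    -- are the dimensions of the graded pieces.
    (∀ n : ℕ, 2 ≤ n →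
      Module.Finite ℚ (BraidChow.ChowRing (BraidChow.braidMatroid n)) ∧
      ∀ k : ℕ, (BraidChow.chowPolynomial n).coeff k =
        (Module.finrank ℚ (BraidChow.chowPiece (BraidChow.braidMatroid n) k) : ℤ)) ∧
    (∀ n : ℕ, 2 ≤ n →
      (Polynomial.X - 1) * BraidChow.chowPolynomial n =
        ∑ k ∈ Finset.Icc 1 (n - 1), BraidChow.chowPolynomial k *
          ∑ j ∈ Finset.Icc k n,
            Polynomial.C (BraidChow.signedStirlingFirst n j * (Nat.stirlingSecond j k : ℤ)) *
              Polynomial.X ^ (j - k)) ∧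
    (∀ n : ℕ, 2 ≤ n →
      (BraidChow.totalDim n : ℤ) =
        ∑ k ∈ Finset.Icc 1 (n - 1), (BraidChow.totalDim k : ℤ) * (n.choose (k - 1) : ℤ) *
          ((n - k - 1).factorial : ℤ) * (-1) ^ (n - k - 1)) := by
  refine ⟨fun n _ => ⟨BraidChow.finite_chowRing n, fun k => ?_⟩, fun n hn => ?_, fun n hn => ?_⟩
  · rw [BraidChow.chowPolynomial_eq, BraidChow.finrank_chowPiece]
  · simp only [BraidChow.chowPolynomial_eq]
    exact BraidChow.X_sub_one_mul_braidPolynomial hn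
  · simp only [BraidChow.totalDim_eq]
    exact BraidChow.eval_one_braidPolynomial hn
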